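/- All graphs are finite and simple. For an integer $k\ge 1$, a graph $G=(V,E)$ with complement edge set $\bar E=\binom V2\setminus E$ is an \emph{inversion-free proper $k$-mixed-thin graph} if there are a partition $(V_1,\dots,V_k)$ of $V$ (parts may be empty) and, for all $1\le i\le j\le k$, a linear order $\le_{ij}$ on $V_i\cup V_j$ and a choice $E_{i,j}\in\{E,\bar E\}$ such that, for all $1\le i\le j\le k$: (a$'$) the restriction of $\le_{ij}$ to $V_i$ equals $\le_{ii}$, and its restriction to $V_j$ equals $\le_{jj}$; (b) whenever $\{u,v\}\subseteq V_i$, $w\in V_j$ or $\{u,v\}\subseteq V_j$, $w\in V_i$, and $u\lneq_{ij}v\lneq_{ij}w$ and $uw\in E_{i,j}$, then $vw\in E_{i,j}$; (c) whenever $\{v,w\}\subseteq V_i$, $u\in V_j$ or $\{v,w\}\subseteq V_j$, $u\in V_i$, and $u\lneq_{ij}v\lneq_{ij}w$ and $uw\in E_{i,j}$, then $uv\in E_{i,j}$. A (non-copying) \emph{FO transduction} $T$ from posets to graphs consists of a finite number of unary relation symbols (marks), a first-order formula $\varphi_0(x)$ and a first-order formula $\varphi_E(x,y)$ over the signature consisting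 of the order relation and the marks. The poset $P$ with arbitrary subsets as marks defines the structure whose domain is the set of all elements of $P$ satisfying $\varphi_0$ and whose edge relation is given by $\varphi_E$; $T(P)$ is the set of all structures (up to isomorphism) obtained in this way over all choices of the marked sets, and $T(\mathcal C)=\bigcup_{P\in\mathcal C}T(P)$. \textbf{Theorem.} For every integer $k\ge1$ there is a non-copying FO transduction $T_k$ such that every inversion-free proper $k$-mixed-thin graph belongs to $T_k(\mathcal P_k)$, where $\mathcal P_k$ is the class of finite posets of width at most $5\binom k2+5k$. Moreover, given a graph $G$ together with a partition $(V_1,\dots,V_k)$ and linear orders $\le_{ij}$ ($1\le i\le j\le k$) for which some choice of the $E_{i,j}$ satisfies the above conditions, a poset $P$ of width at most $5\binom k2+5k$ with $V(G)\subseteq P$, and sets of marked elements of $P$, for which the structure defined by $T_k$ in the marked poset is exactly $G$, can be computed in time polynomial in the size of the input (by one algorithm for all $k$). -/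

import Mathlib

open scoped FirstOrder

universe u

/-! ### First-order interpretations and non-copying transductions -/

namespace FOTransduction

/-- The relation symbols of the signature consisting of `m` unary marks. -/
inductive MarkRel (m : ℕ) : ℕ → Type
  | mark : Fin m → MarkRel m 1

/-- The signature consisting of `m` unary relation symbols (marks). -/
def markLanguage (m : ℕ) : FirstOrder.Language.{0, 0} := ⟨fun _ => Empty, MarkRel m⟩

/-- A choice of the sets of marked elements, as a structure over the signature of marks. -/
@[reducible]
def markStructure {m : ℕ} {A : Type u} (M : Fin m → Set A) : (markLanguage m).Structure A where
  funMap f := Empty.elim f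
  RelMap | .mark i => fun x => x 0 ∈ M i

/-- The expansion of a structure by unary marks. -/
@[reducible]
def markedStructure {L : FirstOrder.Language.{0, 0}} {m : ℕ} {A : Type u} (sA : L.Structure A)
    (M : Fin m → Set A) : (L.sum (markLanguage m)).Structure A :=
  @FirstOrder.Language.sumStructure L (markLanguage m) A sA (markStructure M)

/-- An interpretation of `L'`-structures in `L`-structures (for relational signatures):
a formula defining the domain, and a formula for every relation symbol of `L'`. -/
structure Interpretation (L L' : FirstOrder.Language.{0, 0}) where
  dom : L.Formula (Fin 1)
  rel : ∀ {r : ℕ}, L'.Relations r → L.Formula (Fin r)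

/-- The domain of the interpreted structure: the elements that satisfy the domain formula. -/
def Interpretation.Domain {L L' : FirstOrder.Language.{0, 0}} (I : Interpretation L L') {A : Type u}
    (sA : L.Structure A) : Type u :=
  {a : A // I.dom.Realize (fun _ => a)}

/-- The interpreted structure. -/
instance Interpretation.structure {L L' : FirstOrder.Language.{0, 0}} [L'.IsRelational]
    (I : Interpretation L L') {A : Type u} (sA : L.Structure A) :
    L'.Structure (I.Domain sA) where
  funMap f := isEmptyElim f
  RelMap R := fun x => (I.rel R).Realize (fun i => (x i).1)

/-- A (non-copying) transduction from `L`-structures to `L'`-structures: a finite number of unary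
marks and an interpretation of `L'`-structures in marked `L`-structures. -/
structure Transduction (L L' : FirstOrder.Language.{0, 0}) where
  marks : ℕ
  interp : Interpretation (L.sum (markLanguage marks)) L'

/-- The structure interpreted in the `L`-structure `sA` with marked sets `M` is `sB`, where
`e` tells which element of `A` each element of `B` is. -/
def Transduction.Interprets {L L' : FirstOrder.Language.{0, 0}} [L'.IsRelational] (T : Transduction L L')
    {A B : Type u} (sA : L.Structure A) (M : Fin T.marks → Set A) (sB : L'.Structure B)
    (e : B → A) : Prop :=
  ∃ f : B ≃[L'] T.interp.Domain (markedStructure sA M), ∀ b, (f b).1 = e b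

/-- `T(A)`: all structures (up to isomorphism) interpreted in `A` with arbitrary marks. -/
def Transduction.outputs {L L' : FirstOrder.Language.{0, 0}} [L'.IsRelational] (T : Transduction L L')
    (A : CategoryTheory.Bundled.{u} L.Structure) : Set (CategoryTheory.Bundled.{u} L'.Structure) :=
  {B | ∃ (M : Fin T.marks → Set A) (e : B → A), T.Interprets A.str M B.str e}

/-- `T(C)`: the union of all `T(A)` for `A` in the class `C`. -/
def Transduction.image {L L' : FirstOrder.Language.{0, 0}} [L'.IsRelational] (T : Transduction L L')
    (C : Set (CategoryTheory.Bundled.{u} L.Structure)) :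
    Set (CategoryTheory.Bundled.{u} L'.Structure) :=
  ⋃ A ∈ C, T.outputs A

end FOTransduction

/-! ### Inversion-free proper mixed-thin graphs, and posets of bounded width -/

namespace MixedThin

/-- The binary relation `r` restricts to a (reflexive) linear order on the set `S`. -/
structure LinearOrderOn {V : Type u} (r : V → V → Prop) (S : Set V) : Prop where
  refl : ∀ a ∈ S, r a a
  antisymm : ∀ a ∈ S, ∀ b ∈ S, r a b → r b a → a = b
  trans : ∀ a ∈ S, ∀ b ∈ S, ∀ c ∈ S, r a b → r b c → r a c
  total : ∀ a ∈ S, ∀ b ∈ S, r a b ∨ r b a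

/-- The `i`-th part of the partition given by `part`. -/
def cell {V : Type u} {k : ℕ} (part : V → Fin k) (i : Fin k) : Set V := {v | part v = i}

/-- The parts of `part` and the orders `le i j` on `V_i ∪ V_j`, for `i ≤ j` (the values of `le i j`
outside of `V_i ∪ V_j` and for `i > j` are irrelevant), witness that `G` is an inversion-free proper
`k`-mixed-thin graph; `H` stands for the chosen `E_{i,j}`. -/
structure IsWitness {V : Type u} {k : ℕ} (G : SimpleGraph V) (part : V → Fin k)
    (le : Fin k → Fin k → V → V → Prop) : Prop where
  linear : ∀ i j, i ≤ j → LinearOrderOn (le i j) (cell part i ∪ cell part j)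
  restrict_left : ∀ i j, i ≤ j → ∀ u ∈ cell part i, ∀ v ∈ cell part i, (le i j u v ↔ le i i u v)
  restrict_right : ∀ i j, i ≤ j → ∀ u ∈ cell part j, ∀ v ∈ cell part j, (le i j u v ↔ le j j u v)
  edges : ∃ H : Fin k → Fin k → SimpleGraph V, ∀ i j, i ≤ j →
    (H i j = G ∨ H i j = Gᶜ) ∧
    (∀ u v w, ((u ∈ cell part i ∧ v ∈ cell part i ∧ w ∈ cell part j) ∨
          (u ∈ cell part j ∧ v ∈ cell part j ∧ w ∈ cell part i)) →
        (le i j u v ∧ u ≠ v) → (le i j v w ∧ v ≠ w) → (H i j).Adj u w → (H i j).Adj v w) ∧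
    (∀ u v w, ((v ∈ cell part i ∧ w ∈ cell part i ∧ u ∈ cell part j) ∨
          (v ∈ cell part j ∧ w ∈ cell part j ∧ u ∈ cell part i)) →
        (le i j u v ∧ u ≠ v) → (le i j v w ∧ v ≠ w) → (H i j).Adj u w → (H i j).Adj u v)

/-- The class of (finite) inversion-free proper `k`-mixed-thin graphs. -/
def inversionFreeProper (k : ℕ) : Set (CategoryTheory.Bundled.{u} FirstOrder.Language.graph.Structure) :=
  {B | Finite B ∧ ∃ G : SimpleGraph B, B.str = G.structure ∧
    ∃ (part : B → Fin k) (le : Fin k → Fin k → B → B → Prop), IsWitness G part le}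

/-- The width of the partially ordered set `po` is at most `w`. -/
def WidthLE {X : Type u} (po : PartialOrder X) (w : ℕ) : Prop :=
  ∀ s : Finset X, IsAntichain po.le (s : Set X) → s.card ≤ w

/-- A poset as a relational structure. -/
@[reducible]
def posetStructure {X : Type u} (po : PartialOrder X) : FirstOrder.Language.order.Structure X :=
  @FirstOrder.Language.orderStructure X po.toLE

/-- The class of (finite) posets of width at most `w`. -/
def posetsWidthLE (w : ℕ) : Set (CategoryTheory.Bundled.{u} FirstOrder.Language.order.Structure) :=
  {A | Finite A ∧ ∃ po : PartialOrder A, A.str = posetStructure po ∧ WidthLE po w}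

end MixedThin

/-! ### A random access machine with unit cost -/

namespace RAM

/-- A configuration: directly addressed registers, an indirectly addressed memory, and the output
written so far. -/
structure State where
  reg : ℕ → ℕ
  mem : ℕ → ℕ
  out : List ℕ

/-- The initial configuration. -/
def State.init : State := ⟨fun _ => 0, fun _ => 0, []⟩

/-- Assignment to a register. -/
def State.setReg (s : State) (d x : ℕ) : State := { s with reg := Function.update s.reg d x }

/-- Programs of the machine. The only arithmetic operations are addition and (truncated)
subtraction, so that in `t` steps numbers grow by at most `t` bits. -/
inductive Program
  /-- do nothing -/
  | skip
  /-- `reg d := c` -/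
  | const (d c : ℕ)
  /-- `reg d := reg a + reg b` -/
  | add (d a b : ℕ)
  /-- `reg d := reg a - reg b` -/
  | sub (d a b : ℕ)
  /-- `reg d :=` the entry of the input at position `reg a` (`0` beyond its end) -/
  | input (d a : ℕ)
  /-- `reg d := mem (reg a)` -/
  | load (d a : ℕ)
  /-- `mem (reg a) := reg b` -/
  | store (a b : ℕ)
  /-- append `reg a` to the output -/
  | write (a : ℕ)
  /-- sequential composition -/
  | seq (p q : Program)
  /-- if `reg a ≠ 0` then `p` else `q` -/
  | ite (a : ℕ) (p q : Program)
  /-- while `reg a ≠ 0` do `p` -/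
  | while (a : ℕ) (p : Program)

/-- `Exec inp p s t s'`: on input `inp`, the program `p` started in `s` halts after `t` steps
in `s'`. -/
inductive Exec (inp : List ℕ) : Program → State → ℕ → State → Prop
  | skip (s : State) : Exec inp .skip s 1 s
  | const (s : State) (d c : ℕ) : Exec inp (.const d c) s 1 (s.setReg d c)
  | add (s : State) (d a b : ℕ) : Exec inp (.add d a b) s 1 (s.setReg d (s.reg a + s.reg b))
  | sub (s : State) (d a b : ℕ) : Exec inp (.sub d a b) s 1 (s.setReg d (s.reg a - s.reg b))
  | input (s : State) (d a : ℕ) :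
      Exec inp (.input d a) s 1 (s.setReg d (inp.getD (s.reg a) 0))
  | load (s : State) (d a : ℕ) : Exec inp (.load d a) s 1 (s.setReg d (s.mem (s.reg a)))
  | store (s : State) (a b : ℕ) :
      Exec inp (.store a b) s 1 { s with mem := Function.update s.mem (s.reg a) (s.reg b) }
  | write (s : State) (a : ℕ) : Exec inp (.write a) s 1 { s with out := s.out ++ [s.reg a] }
  | seq {p q : Program} {s s' s'' : State} {t t' : ℕ} :
      Exec inp p s t s' → Exec inp q s' t' s'' → Exec inp (.seq p q) s (t + t') s''
  | ite_true {a : ℕ} {p q : Program} {s s' : State} {t : ℕ} :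
      s.reg a ≠ 0 → Exec inp p s t s' → Exec inp (.ite a p q) s (t + 1) s'
  | ite_false {a : ℕ} {p q : Program} {s s' : State} {t : ℕ} :
      s.reg a = 0 → Exec inp q s t s' → Exec inp (.ite a p q) s (t + 1) s'
  | while_true {a : ℕ} {p : Program} {s s' s'' : State} {t t' : ℕ} :
      s.reg a ≠ 0 → Exec inp p s t s' → Exec inp (.while a p) s' t' s'' →
      Exec inp (.while a p) s (t + t' + 1) s''
  | while_false {a : ℕ} {p : Program} {s : State} :
      s.reg a = 0 → Exec inp (.while a p) s 1 s

/-- On input `inp`, the program halts within `b` steps with output `out`. -/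
def OutputsWithin (p : Program) (inp out : List ℕ) (b : ℕ) : Prop :=
  ∃ (t : ℕ) (s : State), t ≤ b ∧ Exec inp p State.init t s ∧ s.out = out

end RAM

/-! ### Encodings -/

namespace MixedThin

open scoped Classical in
/-- The truth value of a proposition, as `0` or `1`. -/
noncomputable def bit (p : Prop) : ℕ := if p then 1 else 0

/-- The matrix of a binary relation, written row by row. -/
noncomputable def encodeRel {n m : ℕ} (r : Fin n → Fin m → Prop) : List ℕ :=
  (List.finRange n).flatMap fun a => (List.finRange m).map fun b => bit (r a b)

/-- The input: `n`, `k`, the adjacency matrix of the graph, the index of the part of every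
vertex, and for all `i` and `j` the matrix of `le i j` on `V_i ∪ V_j` (zero unless `i ≤ j`). -/
noncomputable def encodeInput {n k : ℕ} (G : SimpleGraph (Fin n)) (part : Fin n → Fin k)
    (le : Fin k → Fin k → Fin n → Fin n → Prop) : List ℕ :=
  [n, k] ++ encodeRel G.Adj ++ (List.finRange n).map (fun v => (part v : ℕ)) ++
    (List.finRange k).flatMap fun i => (List.finRange k).flatMap fun j =>
      encodeRel fun u v : Fin n => i ≤ j ∧ u ∈ cell part i ∪ cell part j ∧
        v ∈ cell part i ∪ cell part j ∧ le i j u v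

/-- The output: the number `N` of elements, the matrix of the order, and for each mark the
characteristic vector of the set of the marked elements. -/
noncomputable def encodeMarkedPoset {N m : ℕ} (po : PartialOrder (Fin N))
    (M : Fin m → Set (Fin N)) : List ℕ :=
  [N] ++ encodeRel po.le ++ encodeRel (fun (c : Fin m) (a : Fin N) => a ∈ M c)

end MixedThin

/-! The compatibility condition (a') glues the orders of all pairs of parts into one relation `ord`,
which is linear on the union of any two parts. For each pair of parts fix E as the edges of G if
these satisfy (b) and (c), and as the non-edges otherwise (`flip`). Write `Sep u w` if u is strictly
before w and uw is not in E. Read contrapositively, (b) and (c) say that `Sep u w` survives when u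
moves down or w moves up inside its own part (`Sep.mono_left`, `Sep.mono_right`). This is the
property that lets `Sep` serve as the order relation between two chains.

The poset consists of k + 2 copies of V, each split by the parts into k chains, so its width is at
most k(k + 2). Copy 0 represents V. Copy i + 2 receives the separations from V_i: an element of V_i
in copy 0 or 1 is below the vertices of copy i + 2 from which it is separated. Copy 0 also lies
below every other copy, part by part, so that a formula can compare an element of another copy with
a vertex. Because of this, a comparison of copy 0 with copy i + 2 may hold without any separation;
copy 1 is below copy i + 2 through `Sep` only, so a path from copy 0 through copy 1 certifies a
separation. Thus `Sep` is definable (`sep_iff_exists`). Two distinct vertices are always ordered one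
way, so `Sep` and the marks recording `flip` give back the edges (`IsWitness.adj_iff`).

Since `flip` depends only on G, the partition and the orders, the marked poset can be computed
without knowing the choice of E. Its order and marks are given by conditions with quantifiers over
vertices, which become arithmetic expressions with bounded sums. A structural induction, done once
for all expressions and statements (`Expr.exists_polynomial`, `Stmt.exists_polynomial`), shows that
these run in polynomial time; what remains is to check their values. -/

namespace MixedThin

/-! ### The poset of copies and its combinatorics. -/

section Combinatorics

variable {V : Type u} {k : ℕ}

/-- The orders `le i j` combined into one relation, which compares `u` and `v` by the order that
belongs to their parts. -/
def ord (part : V → Fin k) (le : Fin k → Fin k → V → V → Prop) (u v : V) : Prop :=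
  le (min (part u) (part v)) (max (part u) (part v)) u v

/-- The convexity conditions for the relation `E` in the place of `E_{i,j}`, with the two vertices
from the same part in `V_i`. -/
def IsConvex (part : V → Fin k) (le : Fin k → Fin k → V → V → Prop) (i j : Fin k)
    (E : V → V → Prop) : Prop :=
  ∀ u v w, part u = i → part v = i → part w = j →
    (ord part le u v ∧ u ≠ v → ord part le v w ∧ v ≠ w → E u w → E v w) ∧
    (ord part le w u ∧ w ≠ u → ord part le u v ∧ u ≠ v → E v w → E u w)

/-- The edges of the graph between `V_i` and `V_j` violate the convexity conditions, so that the complement has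
to be chosen for `E_{i,j}`. -/
def flip (G : SimpleGraph V) (part : V → Fin k) (le : Fin k → Fin k → V → V → Prop)
    (i j : Fin k) : Prop :=
  ¬ (IsConvex part le i j G.Adj ∧ IsConvex part le j i G.Adj)

/-- `u` is before `w`, and they are not adjacent in the relation `E_{i,j}` of their parts. -/
def Sep (G : SimpleGraph V) (part : V → Fin k) (le : Fin k → Fin k → V → V → Prop)
    (u w : V) : Prop :=
  ord part le u w ∧ u ≠ w ∧ (G.Adj u w ↔ flip G part le (part u) (part w))

variable {G : SimpleGraph V} {part : V → Fin k} {le : Fin k → Fin k → V → V → Prop}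

theorem flip_comm (i j : Fin k) : flip G part le i j ↔ flip G part le j i := by
  unfold flip
  rw [and_comm]

/-- This is where (a') enters: for two vertices of one part, `ord` uses the order of that part
alone, and every order involving the part agrees with it. -/
theorem IsWitness.le_iff_ord (h : IsWitness G part le) {i j : Fin k} (hij : i ≤ j) {u v : V}
    (hu : u ∈ cell part i ∪ cell part j) (hv : v ∈ cell part i ∪ cell part j) :
    le i j u v ↔ ord part le u v := by
  unfold ord
  rcases hu with hu | hu <;> rcases hv with hv | hv
  · have hu' : part u = i := hu
    have hv' : part v = i := hv
    rw [hu', hv', min_self, max_self]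
    exact h.restrict_left i j hij u hu v hv
  · have hu' : part u = i := hu
    have hv' : part v = j := hv
    rw [hu', hv', min_eq_left hij, max_eq_right hij]
  · have hu' : part u = j := hu
    have hv' : part v = i := hv
    rw [hu', hv', min_eq_right hij, max_eq_left hij]
  · have hu' : part u = j := hu
    have hv' : part v = j := hv
    rw [hu', hv', min_self, max_self]
    exact h.restrict_right i j hij u hu v hv

theorem IsWitness.linear_ord (h : IsWitness G part le) (i j : Fin k) :
    LinearOrderOn (ord part le) (cell part i ∪ cell part j) := by
  wlog hij : i ≤ j generalizing i j
  · rw [Set.union_comm]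
    exact this j i (le_of_not_ge hij)
  have H := h.linear i j hij
  have E {u v} (hu : u ∈ cell part i ∪ cell part j) (hv : v ∈ cell part i ∪ cell part j) :=
    h.le_iff_ord hij hu hv
  refine ⟨fun a ha => (E ha ha).1 (H.refl a ha), fun a ha b hb h1 h2 => ?_,
    fun a ha b hb c hc h1 h2 => ?_, fun a ha b hb => ?_⟩
  · exact H.antisymm a ha b hb ((E ha hb).2 h1) ((E hb ha).2 h2)
  · exact (E ha hc).1 (H.trans a ha b hb c hc ((E ha hb).2 h1) ((E hb hc).2 h2))
  · rw [← E ha hb, ← E hb ha]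
    exact H.total a ha b hb

theorem IsWitness.refl (h : IsWitness G part le) (u : V) : ord part le u u :=
  (h.linear_ord (part u) (part u)).refl u (Or.inl rfl)

theorem IsWitness.antisymm (h : IsWitness G part le) {u v : V} (h1 : ord part le u v)
    (h2 : ord part le v u) : u = v :=
  (h.linear_ord (part u) (part v)).antisymm u (Or.inl rfl) v (Or.inr rfl) h1 h2

theorem IsWitness.total (h : IsWitness G part le) (u v : V) : ord part le u v ∨ ord part le v u :=
  (h.linear_ord (part u) (part v)).total u (Or.inl rfl) v (Or.inr rfl)

/-- `ord` need not be transitive across three different parts; the poset only uses triples in which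
two consecutive vertices share a part. -/
theorem IsWitness.trans_left (h : IsWitness G part le) {u v w : V} (huv : part u = part v)
    (h1 : ord part le u v) (h2 : ord part le v w) : ord part le u w :=
  (h.linear_ord (part u) (part w)).trans u (Or.inl rfl) v (Or.inl huv.symm) w (Or.inr rfl) h1 h2

theorem IsWitness.trans_right (h : IsWitness G part le) {u v w : V} (hvw : part v = part w)
    (h1 : ord part le u v) (h2 : ord part le v w) : ord part le u w :=
  (h.linear_ord (part u) (part w)).trans u (Or.inl rfl) v (Or.inr hvw) w (Or.inr rfl) h1 h2

theorem IsWitness.exists_isConvex (h : IsWitness G part le) (i j : Fin k) :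
    ∃ H : SimpleGraph V, (H = G ∨ H = Gᶜ) ∧
      IsConvex part le i j H.Adj ∧ IsConvex part le j i H.Adj := by
  wlog hij : i ≤ j generalizing i j
  · obtain ⟨H, h1, h2, h3⟩ := this j i (le_of_not_ge hij)
    exact ⟨H, h1, h3, h2⟩
  obtain ⟨H, hH⟩ := h.edges
  obtain ⟨h1, hb, hc⟩ := hH i j hij
  have E {u v} (hu : u ∈ cell part i ∪ cell part j) (hv : v ∈ cell part i ∪ cell part j) :=
    h.le_iff_ord hij hu hv
  refine ⟨H i j, h1, fun u v w hu hv hw => ⟨fun huv hvw a => ?_, fun hwu huv a => ?_⟩,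
    fun u v w hu hv hw => ⟨fun huv hvw a => ?_, fun hwu huv a => ?_⟩⟩
  · rw [← E (Or.inl hu) (Or.inl hv)] at huv
    rw [← E (Or.inl hv) (Or.inr hw)] at hvw
    exact hb u v w (Or.inl ⟨hu, hv, hw⟩) huv hvw a
  · rw [← E (Or.inl hu) (Or.inl hv)] at huv
    rw [← E (Or.inr hw) (Or.inl hu)] at hwu
    exact (hc w u v (Or.inl ⟨hu, hv, hw⟩) hwu huv a.symm).symm
  · rw [← E (Or.inr hu) (Or.inr hv)] at huv
    rw [← E (Or.inr hv) (Or.inl hw)] at hvw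
    exact hb u v w (Or.inr ⟨hu, hv, hw⟩) huv hvw a
  · rw [← E (Or.inr hu) (Or.inr hv)] at huv
    rw [← E (Or.inl hw) (Or.inr hu)] at hwu
    exact (hc w u v (Or.inr ⟨hu, hv, hw⟩) hwu huv a.symm).symm

/-- The relation is the complement of G if `flip` holds and G otherwise. If G violates the
conditions, the choice that exists by hypothesis must have been the complement, so the canonical
choice is always valid. -/
theorem IsWitness.isConvex (h : IsWitness G part le) (i j : Fin k) :
    IsConvex part le i j fun u w => u ≠ w ∧ ¬ (G.Adj u w ↔ flip G part le i j) := by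
  by_cases hf : flip G part le i j
  · obtain ⟨H, rfl | rfl, h1, h2⟩ := h.exists_isConvex i j
    · exact absurd ⟨h1, h2⟩ hf
    · have : (fun u w => u ≠ w ∧ ¬ (G.Adj u w ↔ flip G part le i j)) = Gᶜ.Adj := by
        funext u w
        simp [hf, SimpleGraph.compl_adj]
      rwa [this]
  · have h1 := (not_not.1 hf).1
    have : (fun u w => u ≠ w ∧ ¬ (G.Adj u w ↔ flip G part le i j)) = G.Adj := by
      funext u w
      simpa [hf] using fun h : G.Adj u w => h.ne
    rwa [this]

/-- Contraposition of (b): with u' before u before w, if u'w were in E then so would be uw. -/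
theorem Sep.mono_left (h : IsWitness G part le) {u u' w : V} (hs : Sep G part le u w)
    (hp : part u' = part u) (ho : ord part le u' u) : Sep G part le u' w := by
  obtain ⟨h1, h2, h3⟩ := hs
  rcases eq_or_ne u' u with rfl | hne
  · exact ⟨h1, h2, h3⟩
  have h4 : ord part le u' w := h.trans_left hp ho h1
  have h5 : u' ≠ w := by
    rintro rfl
    exact hne (h.antisymm ho h1)
  refine ⟨h4, h5, ?_⟩
  by_contra h6
  rw [hp] at h6
  exact (((h.isConvex (part u) (part w)) u' u w hp rfl rfl).1 ⟨ho, hne⟩ ⟨h1, h2⟩ ⟨h5, h6⟩).2 h3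

/-- Contraposition of (c). The pair from one part is now w, w', so adjacency and `flip` are first
turned around to match `IsConvex`. -/
theorem Sep.mono_right (h : IsWitness G part le) {u w w' : V} (hs : Sep G part le u w)
    (hp : part w = part w') (ho : ord part le w w') : Sep G part le u w' := by
  obtain ⟨h1, h2, h3⟩ := hs
  rcases eq_or_ne w w' with rfl | hne
  · exact ⟨h1, h2, h3⟩
  have h4 : ord part le u w' := h.trans_right hp h1 ho
  have h5 : u ≠ w' := by
    rintro rfl
    exact hne (h.antisymm ho h1)
  refine ⟨h4, h5, ?_⟩
  by_contra h6
  rw [← hp, SimpleGraph.adj_comm, flip_comm] at h6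
  rw [SimpleGraph.adj_comm, flip_comm] at h3
  exact (((h.isConvex (part w) (part u)) w w' u rfl hp.symm rfl).2 ⟨h1, h2⟩ ⟨ho, hne⟩
    ⟨h5.symm, h6⟩).2 h3

/-- By totality of `ord`, distinct u and w are separated in one of the two directions exactly when
uw is not in E, that is, when adjacency agrees with `flip`. -/
theorem IsWitness.adj_iff (h : IsWitness G part le) (u w : V) :
    G.Adj u w ↔ u ≠ w ∧
      ((Sep G part le u w ∨ Sep G part le w u) ↔ flip G part le (part u) (part w)) := by
  rcases eq_or_ne u w with rfl | hne
  · simp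
  have : Sep G part le u w ∨ Sep G part le w u ↔
      (G.Adj u w ↔ flip G part le (part u) (part w)) := by
    have := h.total u w
    unfold Sep
    rw [G.adj_comm w u, flip_comm (part w) (part u)]
    tauto
  rw [this]
  tauto

/-- The order on `k + 2` copies of `V`: in every copy the parts are chains, the copy `0` is below
the copy `1`, and copy `i + 2` describes which vertices of `V_i` are separated from a vertex. -/
def CopiesLE (G : SimpleGraph V) (part : V → Fin k) (le : Fin k → Fin k → V → V → Prop)
    (a b : Fin (k + 2) × V) : Prop :=
  ((a.1 = b.1 ∨ (a.1 : ℕ) = 0) ∧ part a.2 = part b.2 ∧ ord part le a.2 b.2) ∨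
    ((a.1 : ℕ) ≤ 1 ∧ (b.1 : ℕ) = part a.2 + 2 ∧ Sep G part le a.2 b.2)

/-- The order on the copies of `V`, transported to a type `A`. -/
@[reducible]
def copiesOrder (h : IsWitness G part le) {A : Type u} (σ : A ≃ Fin (k + 2) × V) :
    PartialOrder A where
  le a b := CopiesLE G part le (σ a) (σ b)
  le_refl a := Or.inl ⟨Or.inl rfl, rfl, h.refl _⟩
  le_trans a b c := by
    generalize σ a = a
    generalize σ b = b
    generalize σ c = c
    rintro (⟨h1, h2, h3⟩ | ⟨h1, h2, h3⟩) (⟨h4, h5, h6⟩ | ⟨h4, h5, h6⟩)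
    · refine Or.inl ⟨?_, h2.trans h5, h.trans_left h2 h3 h6⟩
      rcases h1 with h1 | h1
      · rwa [h1]
      · exact Or.inr h1
    · refine Or.inr ⟨?_, by rw [h2, h5], h6.mono_left h h2 h3⟩
      rcases h1 with h1 | h1
      · rwa [h1]
      · omega
    -- A separation ends in a copy with index at least 2, so the next comparison cannot start in
    -- copy 0 and stays in the same copy.
    · have h7 : b.1 = c.1 := h4.resolve_right (by omega)
      exact Or.inr ⟨h1, by rw [← h7, h2], h3.mono_right h h5 h6⟩
    -- Two separations never compose: the first ends in a copy with index at least 2, the second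
    -- starts in copy 0 or 1.
    · omega
  le_antisymm a b hab hba := by
    apply σ.injective
    revert hab hba
    generalize σ a = a
    generalize σ b = b
    rintro (⟨h1, h2, h3⟩ | ⟨h1, h2, h3⟩) (⟨h4, h5, h6⟩ | ⟨h4, h5, h6⟩)
    · refine Prod.ext ?_ (h.antisymm h3 h6)
      apply Fin.ext
      have h1' := h1.imp_left (congrArg Fin.val)
      have h4' := h4.imp_left (congrArg Fin.val)
      omega
    · rw [Fin.ext_iff] at h1
      omega
    · rw [Fin.ext_iff] at h4
      omega
    · omega

/-- Each part of each copy is a chain, so an antichain has at most k(k + 2) elements, and 2k(k + 2)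
≤ 5k(k - 1) + 10k. -/
theorem widthLE_copiesOrder (h : IsWitness G part le) {A : Type u} (σ : A ≃ Fin (k + 2) × V) :
    WidthLE (copiesOrder h σ) (5 * k.choose 2 + 5 * k) := by
  intro s hs
  have hinj : Set.InjOn (fun a => ((σ a).1, part (σ a).2)) (s : Set A) := by
    intro a ha b hb hab
    by_contra hne
    obtain ⟨h1, h2⟩ := Prod.ext_iff.1 hab
    rcases h.total (σ a).2 (σ b).2 with h3 | h3
    · exact hs ha hb hne (Or.inl ⟨Or.inl h1, h2, h3⟩)
    · exact hs hb ha (Ne.symm hne) (Or.inl ⟨Or.inl h1.symm, h2.symm, h3⟩)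
  have hcard := Finset.card_le_card_of_injOn _ (t := Finset.univ) (fun _ _ => Finset.mem_univ _) hinj
  rw [Finset.card_univ, Fintype.card_prod, Fintype.card_fin, Fintype.card_fin] at hcard
  have h2 : k.choose 2 * 2 = k * (k - 1) := by
    rw [Nat.choose_two_right, Nat.div_mul_cancel (Nat.even_mul_pred_self k).two_dvd]
  refine hcard.trans ?_
  rcases k with _ | k
  · simp
  · rw [Nat.add_sub_cancel] at h2
    nlinarith

/-- The marks: the parts, the copies, and for every `j` the vertices from the parts `V_i` for which
the complement is chosen for `E_{i,j}`. -/
def copiesMark (G : SimpleGraph V) (part : V → Fin k) (le : Fin k → Fin k → V → V → Prop)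
    (c : ℕ) (a : Fin (k + 2) × V) : Prop :=
  (part a.2 : ℕ) = c ∨ (a.1 : ℕ) + k = c ∨
    ∃ j : Fin k, (j : ℕ) + (2 * k + 2) = c ∧ flip G part le (part a.2) j

/-- The three families of marks occupy the disjoint ranges [0, k), [k, 2k + 2) and [2k + 2, 3k + 2),
so the number of a mark selects one disjunct. -/
theorem copiesMark_part (j : Fin k) (a : Fin (k + 2) × V) :
    copiesMark G part le j a ↔ part a.2 = j := by
  simp only [copiesMark, Fin.ext_iff]
  constructor
  · rintro (h | h | ⟨_, h, -⟩) <;> omega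
  · exact Or.inl

theorem copiesMark_copy (q : ℕ) (hq : q < k + 2) (a : Fin (k + 2) × V) :
    copiesMark G part le (q + k) a ↔ (a.1 : ℕ) = q := by
  simp only [copiesMark]
  constructor
  · rintro (h | h | ⟨_, h, -⟩) <;> omega
  · intro h
    omega

theorem copiesMark_flip (j : Fin k) (a : Fin (k + 2) × V) :
    copiesMark G part le (j + (2 * k + 2)) a ↔ flip G part le (part a.2) j := by
  simp only [copiesMark]
  constructor
  · rintro (h | h | ⟨i, h, h'⟩)
    · omega
    · omega
    · rwa [show j = i from Fin.ext (by omega)]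
  · exact fun h => Or.inr (Or.inr ⟨j, rfl, h⟩)

/-- The element b in copy 1 forces the step up to t to be a separation. The last condition says that
the vertex of t is at most y, expressed through the elements of copy 0 below t. Monotonicity of
`Sep` then carries the separation to x and y. -/
theorem sep_iff_exists (h : IsWitness G part le) (x y : V) :
    Sep G part le x y ↔ ∃ b t : Fin (k + 2) × V, (b.1 : ℕ) = 1 ∧ (t.1 : ℕ) = part x + 2 ∧
      part t.2 = part y ∧ CopiesLE G part le (0, x) b ∧ CopiesLE G part le b t ∧
      ∀ v : Fin (k + 2) × V, (v.1 : ℕ) = 0 → part v.2 = part y → CopiesLE G part le v t →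
        CopiesLE G part le v (0, y) := by
  constructor
  · intro hs
    refine ⟨(1, x), ((part x).addNat 2, y), by simp, by simp, rfl, ?_, ?_, ?_⟩
    · exact Or.inl ⟨Or.inr rfl, rfl, h.refl _⟩
    · exact Or.inr ⟨by simp, by simp, hs⟩
    · rintro v hv hp (⟨-, -, h3⟩ | ⟨-, -, h3⟩)
      · exact Or.inl ⟨Or.inr hv, hp, h3⟩
      -- An element of copy 0 may also lie below t by a separation, but a separation includes being
      -- before.
      · exact Or.inl ⟨Or.inr hv, hp, h3.1⟩
  · rintro ⟨b, t, hb, ht, hp, h1, h2, h3⟩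
    -- Testing with the copy of t in copy 0 yields that its vertex is at most y.
    have h4 := h3 (0, t.2) rfl hp (Or.inl ⟨Or.inr rfl, rfl, h.refl _⟩)
    obtain ⟨-, -, h4⟩ | ⟨-, h4, -⟩ := h4
    · obtain ⟨-, h5, h6⟩ | ⟨-, h5, -⟩ := h1
      · obtain ⟨h7 | h7, -⟩ | ⟨-, -, h7⟩ := h2
        · rw [Fin.ext_iff] at h7
          omega
        · omega
        · exact (h7.mono_left h h5 h6).mono_right h hp h4
      · simp only at h5
        omega
    · simp at h4

end Combinatorics

end MixedThin

/-! ### The first-order formulas and the transduction. -/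

namespace MixedThin

open FOTransduction FirstOrder FirstOrder.Language

/-- The signature of posets with `m` marks. -/
abbrev markedOrder (m : ℕ) : FirstOrder.Language.{0, 0} := FirstOrder.Language.order.sum (markLanguage m)

section Formulas

variable {m n : ℕ} {α : Type}

/-- The formula `s ≤ t`. -/
def leFormula (s t : (markedOrder m).Term (α ⊕ Fin n)) : (markedOrder m).BoundedFormula α n :=
  Relations.boundedFormula₂ (L := markedOrder m) (Sum.inl orderRel.le) s t

/-- The formula saying that `t` has the mark `c`. -/
def markFormula (c : Fin m) (t : (markedOrder m).Term (α ⊕ Fin n)) :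
    (markedOrder m).BoundedFormula α n :=
  Relations.boundedFormula₁ (L := markedOrder m) (Sum.inr (MarkRel.mark c)) t

variable {A : Type u} (po : PartialOrder A) (M : Fin m → Set A)

theorem realize_leFormula (s t : (markedOrder m).Term (α ⊕ Fin n)) (v : α → A) (xs : Fin n → A) :
    letI := markedStructure (posetStructure po) M
    (leFormula s t).Realize v xs ↔
      po.le (s.realize (Sum.elim v xs)) (t.realize (Sum.elim v xs)) := by
  let _ := markedStructure (posetStructure po) M
  exact BoundedFormula.realize_rel₂ (L := markedOrder m)

theorem realize_markFormula (c : Fin m) (t : (markedOrder m).Term (α ⊕ Fin n)) (v : α → A)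
    (xs : Fin n → A) :
    letI := markedStructure (posetStructure po) M
    (markFormula c t).Realize v xs ↔ t.realize (Sum.elim v xs) ∈ M c := by
  let _ := markedStructure (posetStructure po) M
  exact BoundedFormula.realize_rel₁ (L := markedOrder m)

end Formulas

section Transduction

variable (k : ℕ)

/-- The mark of the `i`-th part. -/
def partMark (i : Fin k) : Fin (3 * k + 2) := ⟨i, by omega⟩

/-- The mark of the `q`-th copy. -/
def copyMark (q : Fin (k + 2)) : Fin (3 * k + 2) := ⟨q + k, by omega⟩

/-- The mark of the parts `V_i` for which the complement is chosen for `E_{i,j}`. -/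
def flipMark (j : Fin k) : Fin (3 * k + 2) := ⟨j + (2 * k + 2), by omega⟩

/-- The formula saying that `x` from `V_i` and `y` from `V_j` are separated. -/
def sepFormula (i j : Fin k) (x y : Fin 2) : (markedOrder (3 * k + 2)).BoundedFormula (Fin 2) 0 :=
  ∃' ∃' (markFormula (copyMark k 1) (&0) ⊓ markFormula (copyMark k (i.addNat 2)) (&1) ⊓
    markFormula (partMark k j) (&1) ⊓ leFormula (Term.var (Sum.inl x)) (&0) ⊓
    leFormula (&0) (&1) ⊓
    ∀' (markFormula (copyMark k 0) (&2) ⟹ markFormula (partMark k j) (&2) ⟹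
      leFormula (&2) (&1) ⟹ leFormula (&2) (Term.var (Sum.inl y))))

/-- The formula saying that `x` and `y` are adjacent. -/
noncomputable def adjFormula : (markedOrder (3 * k + 2)).Formula (Fin 2) :=
  ∼(Term.bdEqual (Term.var (Sum.inl 0)) (Term.var (Sum.inl 1))) ⊓
    BoundedFormula.iSup fun i : Fin k => BoundedFormula.iSup fun j : Fin k =>
      markFormula (partMark k i) (Term.var (Sum.inl 0)) ⊓
      markFormula (partMark k j) (Term.var (Sum.inl 1)) ⊓
      ((sepFormula k i j 0 1 ⊔ sepFormula k j i 1 0) ⇔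
        markFormula (flipMark k j) (Term.var (Sum.inl 0)))

/-- The transduction producing the inversion-free proper `k`-mixed-thin graphs. -/
noncomputable def transduction : Transduction FirstOrder.Language.order FirstOrder.Language.graph where
  marks := 3 * k + 2
  interp :=
    { dom := markFormula (copyMark k 0) (Term.var (Sum.inl 0))
      rel := fun | .adj => adjFormula k }

variable {k} {V : Type u} {G : SimpleGraph V} {part : V → Fin k}
  {le : Fin k → Fin k → V → V → Prop}

theorem realize_sepFormula (h : IsWitness G part le) {A : Type u} (σ : A ≃ Fin (k + 2) × V)
    (x y : Fin 2) (w : Fin 2 → A) (xs : Fin 0 → A) (hx : ((σ (w x)).1 : ℕ) = 0)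
    (hy : ((σ (w y)).1 : ℕ) = 0) :
    letI := markedStructure (posetStructure (copiesOrder h σ))
      (fun c : Fin (3 * k + 2) => {a | copiesMark G part le c (σ a)})
    (sepFormula k (part (σ (w x)).2) (part (σ (w y)).2) x y).Realize w xs ↔
      Sep G part le (σ (w x)).2 (σ (w y)).2 := by
  let _ := markedStructure (posetStructure (copiesOrder h σ))
      (fun c : Fin (3 * k + 2) => {a | copiesMark G part le c (σ a)})
  have ex : σ (w x) = (0, (σ (w x)).2) := Prod.ext (Fin.ext hx) rfl
  have ey : σ (w y) = (0, (σ (w y)).2) := Prod.ext (Fin.ext hy) rfl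
  rw [sep_iff_exists h]
  unfold sepFormula
  simp only [BoundedFormula.realize_ex, BoundedFormula.realize_inf, BoundedFormula.realize_all,
    BoundedFormula.realize_imp, realize_leFormula, realize_markFormula, Term.realize_var,
    Sum.elim_inl, Set.mem_ofPred_eq, copyMark, partMark, copiesMark_part,
    copiesMark_copy _ (Fin.isLt _)]
  have e1 : ((1 : Fin (k + 2)) : ℕ) = 1 := by simp
  constructor
  · rintro ⟨b, t, ⟨⟨⟨⟨⟨h1, h2⟩, h3⟩, h4⟩, h5⟩, h6⟩⟩
    refine ⟨σ b, σ t, h1.trans e1, h2, h3, ex ▸ h4, h5, fun v hv hp hl => ?_⟩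
    have h7 := h6 (σ.symm v)
    change ((σ (σ.symm v)).1 : ℕ) = 0 → part (σ (σ.symm v)).2 = _ →
      CopiesLE G part le (σ (σ.symm v)) (σ t) → CopiesLE G part le (σ (σ.symm v)) (σ (w y)) at h7
    rw [σ.apply_symm_apply, ey] at h7
    exact h7 hv hp hl
  · rintro ⟨b, t, h1, h2, h3, h4, h5, h6⟩
    obtain ⟨b, rfl⟩ := σ.surjective b
    obtain ⟨t, rfl⟩ := σ.surjective t
    refine ⟨b, t, ⟨⟨⟨⟨⟨h1.trans e1.symm, h2⟩, h3⟩, ?_⟩, h5⟩, fun v hv hp hl => ?_⟩⟩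
    · rw [← ex] at h4
      exact h4
    · rw [← ey] at h6
      exact h6 (σ v) hv hp hl

theorem realize_adjFormula (h : IsWitness G part le) {A : Type u} (σ : A ≃ Fin (k + 2) × V)
    (w : Fin 2 → A) (h0 : ((σ (w 0)).1 : ℕ) = 0) (h1 : ((σ (w 1)).1 : ℕ) = 0) :
    letI := markedStructure (posetStructure (copiesOrder h σ))
      (fun c : Fin (3 * k + 2) => {a | copiesMark G part le c (σ a)})
    (adjFormula k).Realize w ↔ G.Adj (σ (w 0)).2 (σ (w 1)).2 := by
  let _ := markedStructure (posetStructure (copiesOrder h σ))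
      (fun c : Fin (3 * k + 2) => {a | copiesMark G part le c (σ a)})
  have hne : w 0 = w 1 ↔ (σ (w 0)).2 = (σ (w 1)).2 := by
    rw [← σ.injective.eq_iff, Prod.ext_iff, and_iff_right (Fin.ext (h0.trans h1.symm))]
  unfold adjFormula Formula.Realize
  simp only [BoundedFormula.realize_inf, BoundedFormula.realize_iSup, BoundedFormula.realize_iff,
    BoundedFormula.realize_not, BoundedFormula.realize_bdEqual, BoundedFormula.realize_sup,
    realize_markFormula, Term.realize_var, Sum.elim_inl, Set.mem_ofPred_eq, flipMark, partMark,
    copiesMark_part, copiesMark_flip]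
  rw [h.adj_iff, hne]
  refine and_congr_right fun _ => ?_
  constructor
  -- The part marks determine i and j, so only one disjunct can hold.
  · rintro ⟨i, j, ⟨rfl, rfl⟩, h2⟩
    rwa [realize_sepFormula h σ 0 1 w _ h0 h1, realize_sepFormula h σ 1 0 w _ h1 h0] at h2
  · intro h2
    refine ⟨_, _, ⟨rfl, rfl⟩, ?_⟩
    rwa [realize_sepFormula h σ 0 1 w _ h0 h1, realize_sepFormula h σ 1 0 w _ h1 h0]

/-- The domain formula selects copy 0. The bijection σ is arbitrary because two carriers are needed:
a lifted product for arbitrary universes and `Fin ((k + 2) * n)` for the algorithm. -/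
theorem interprets_transduction (h : IsWitness G part le) {A : Type u}
    (σ : A ≃ Fin (k + 2) × V) :
    (transduction k).Interprets (posetStructure (copiesOrder h σ))
      (fun c : Fin (3 * k + 2) => {a | copiesMark G part le c (σ a)}) G.structure
      (fun v => σ.symm (0, v)) := by
  let sA := markedStructure (posetStructure (copiesOrder h σ))
      (fun c : Fin (3 * k + 2) => {a | copiesMark G part le c (σ a)})
  have hdom (a : A) : @Formula.Realize (markedOrder (3 * k + 2)) A sA _
      (transduction k).interp.dom (fun _ => a) ↔ ((σ a).1 : ℕ) = 0 := by
    refine (realize_markFormula _ _ _ _ _ _).trans ?_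
    exact copiesMark_copy (0 : Fin (k + 2)) (Fin.isLt _) (σ a)
  let := G.structure
  refine ⟨⟨⟨fun v => ⟨σ.symm (0, v), (hdom _).2 (by simp)⟩, fun a => (σ a.1).2,
    fun v => by simp, fun a => ?_⟩, fun f => isEmptyElim f, ?_⟩, fun v => rfl⟩
  · apply Subtype.ext
    rw [σ.symm_apply_eq]
    exact Prod.ext (Fin.ext ((hdom _).1 a.2).symm) rfl
  · rintro _ ⟨⟩ x
    refine (realize_adjFormula h σ _ ?_ ?_).trans ?_
    · change ((σ (σ.symm (0, x 0))).1 : ℕ) = 0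
      simp
    · change ((σ (σ.symm (0, x 1))).1 : ℕ) = 0
      simp
    · change G.Adj (σ (σ.symm (0, x 0))).2 (σ (σ.symm (0, x 1))).2 ↔ G.Adj (x 0) (x 1)
      simp

theorem inversionFreeProper_subset (k : ℕ) :
    inversionFreeProper.{u} k ⊆
      (transduction k).image (posetsWidthLE.{u} (5 * k.choose 2 + 5 * k)) := by
  rintro ⟨V, sV⟩ ⟨hfin, G, hG, part, le, h⟩
  have hfin : Finite V := hfin
  let σ : (ULift.{u} (Fin (k + 2)) × V) ≃ Fin (k + 2) × V := Equiv.ulift.prodCongr (Equiv.refl V)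
  have hG : sV = G.structure := hG
  refine Set.mem_iUnion₂.2 ⟨⟨ULift.{u} (Fin (k + 2)) × V, posetStructure (copiesOrder h σ)⟩,
    ⟨inferInstanceAs (Finite (ULift.{u} (Fin (k + 2)) × V)), copiesOrder h σ, rfl,
      widthLE_copiesOrder h σ⟩,
    (fun c : Fin (3 * k + 2) => {a | copiesMark G part le c (σ a)} :
      Fin (3 * k + 2) → Set (ULift.{u} (Fin (k + 2)) × V)),
    (fun v : V => σ.symm (0, v)), ?_⟩
  change (transduction k).Interprets (posetStructure (copiesOrder h σ)) _ sV _
  rw [hG]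
  exact interprets_transduction h σ

end Transduction

end MixedThin

/-! ### Running times and loops of machine programs. -/

namespace RAM

section Runs

/-- The program `p` halts within `T` steps in a state that satisfies `Q`. -/
def Runs (inp : List ℕ) (p : Program) (s : State) (T : ℕ) (Q : State → Prop) : Prop :=
  ∃ t s', t ≤ T ∧ Exec inp p s t s' ∧ Q s'

variable {inp : List ℕ} {p q : Program} {s : State} {T T' : ℕ} {Q R : State → Prop}

theorem Runs.mono (h : Runs inp p s T Q) (hT : T ≤ T') (hQ : ∀ s', Q s' → R s') :
    Runs inp p s T' R := by
  obtain ⟨t, s', h1, h2, h3⟩ := h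
  exact ⟨t, s', h1.trans hT, h2, hQ s' h3⟩

theorem Runs.seq (h : Runs inp p s T Q) (h' : ∀ s', Q s' → Runs inp q s' T' R) :
    Runs inp (.seq p q) s (T + T') R := by
  obtain ⟨t, s', h1, h2, h3⟩ := h
  obtain ⟨t', s'', h1', h2', h3'⟩ := h' s' h3
  exact ⟨t + t', s'', by omega, .seq h2 h2', h3'⟩

theorem Runs.const {d c : ℕ} (h : Q (s.setReg d c)) : Runs inp (.const d c) s 1 Q :=
  ⟨1, _, le_rfl, .const s d c, h⟩

theorem Runs.add {d a b : ℕ} (h : Q (s.setReg d (s.reg a + s.reg b))) :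
    Runs inp (.add d a b) s 1 Q :=
  ⟨1, _, le_rfl, .add s d a b, h⟩

theorem Runs.sub {d a b : ℕ} (h : Q (s.setReg d (s.reg a - s.reg b))) :
    Runs inp (.sub d a b) s 1 Q :=
  ⟨1, _, le_rfl, .sub s d a b, h⟩

theorem Runs.input {d a : ℕ} (h : Q (s.setReg d (inp.getD (s.reg a) 0))) :
    Runs inp (.input d a) s 1 Q :=
  ⟨1, _, le_rfl, .input s d a, h⟩

theorem Runs.write {a : ℕ} (h : Q { s with out := s.out ++ [s.reg a] }) :
    Runs inp (.write a) s 1 Q :=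
  ⟨1, _, le_rfl, .write s a, h⟩

theorem State.reg_setReg (s : State) (d x y : ℕ) :
    (s.setReg d x).reg y = if y = d then x else s.reg y :=
  Function.update_apply ..

theorem State.out_setReg (s : State) (d x : ℕ) : (s.setReg d x).out = s.out := rfl

/-- Execute `body` with the values `0, …, reg d - 1` in the register `x`, whose value is restored
in the end. The registers `d`, `d + 1` and `d + 2` are used for the control of the loop. -/
def forLoop (x d : ℕ) (body : Program) : Program :=
  .seq (.const (d + 1) 0) <| .seq (.add (d + 2) x (d + 1)) <| .seq (.const (d + 1) 1) <|
  .seq (.const x 0) <|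
  .seq (.while d (.seq body (.seq (.add x x (d + 1)) (.sub d d (d + 1))))) <|
  .seq (.const (d + 1) 0) (.add x (d + 2) (d + 1))

variable {x d m : ℕ} {body : Program} {r : ℕ → ℕ} {P : ℕ → State → Prop}

/-- Induction on the number j of remaining rounds: register d counts down, x counts up, d + 1 holds
the constant 1 and d + 2 the saved value of x. The invariant P may depend only on the output and on
registers beyond d + 2, so loop control cannot disturb it. A round costs the body, two arithmetic
steps and the test. -/
theorem runs_while (hx : x < d)
    (hP : ∀ i s s', P i s → (∀ y, d + 2 < y → s'.reg y = s.reg y) → s'.out = s.out → P i s')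
    (hbody : ∀ i < m, ∀ s : State, (∀ y < d, y ≠ x → s.reg y = r y) → s.reg x = i → P i s →
      Runs inp body s T fun s' => (∀ y ≤ d + 2, s'.reg y = s.reg y) ∧ P (i + 1) s')
    (j i : ℕ) (hij : i + j = m) (s : State) (hr : ∀ y < d, y ≠ x → s.reg y = r y)
    (hsx : s.reg x = i) (hsd : s.reg d = j) (h1 : s.reg (d + 1) = 1) (h2 : s.reg (d + 2) = r x)
    (hPs : P i s) :
    Runs inp (.while d (.seq body (.seq (.add x x (d + 1)) (.sub d d (d + 1))))) s
      (j * (T + 3) + 1)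
      fun s' => (∀ y < d, y ≠ x → s'.reg y = r y) ∧ s'.reg (d + 2) = r x ∧ P m s' := by
  induction j generalizing i s with
  | zero =>
    obtain rfl : i = m := hij
    exact ⟨1, s, by omega, .while_false hsd, hr, h2, hPs⟩
  | succ j ih =>
    have step : Runs inp (.seq body (.seq (.add x x (d + 1)) (.sub d d (d + 1)))) s (T + (1 + 1))
        fun s' => (∀ y < d, y ≠ x → s'.reg y = r y) ∧ s'.reg x = i + 1 ∧ s'.reg d = j ∧
          s'.reg (d + 1) = 1 ∧ s'.reg (d + 2) = r x ∧ P (i + 1) s' := by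
      refine (hbody i (by omega) s hr hsx hPs).seq fun s' hs' => ?_
      obtain ⟨hs', hP'⟩ := hs'
      refine Runs.seq (Runs.add (Q := fun s'' => s'' = _) rfl) ?_
      rintro _ rfl
      refine Runs.sub ?_
      refine ⟨fun y hy hyx => ?_, ?_, ?_, ?_, ?_, ?_⟩
      · rw [State.reg_setReg, if_neg (by omega), State.reg_setReg, if_neg hyx, hs' y (by omega),
          hr y hy hyx]
      · rw [State.reg_setReg, if_neg (by omega), State.reg_setReg, if_pos rfl, hs' x (by omega),
          hs' _ (by omega), hsx, h1]
      · rw [State.reg_setReg, if_pos rfl, State.reg_setReg, if_neg (by omega), State.reg_setReg,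
          if_neg (by omega), hs' _ (by omega), hs' _ (by omega), hsd, h1, Nat.add_sub_cancel]
      · rw [State.reg_setReg, if_neg (by omega), State.reg_setReg, if_neg (by omega),
          hs' _ (by omega), h1]
      · rw [State.reg_setReg, if_neg (by omega), State.reg_setReg, if_neg (by omega),
          hs' _ (by omega), h2]
      · refine hP _ _ _ hP' (fun y hy => ?_) rfl
        rw [State.reg_setReg, if_neg (by omega), State.reg_setReg, if_neg (by omega)]
    obtain ⟨t, s', ht, hex, h3, h4, h5, h6, h7, h8⟩ := step
    obtain ⟨t', s'', ht', hex', h9⟩ := ih (i + 1) (by omega) s' h3 h4 h5 h6 h7 h8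
    refine ⟨t + t' + 1, s'', ?_, .while_true (by omega) hex hex', h9⟩
    rw [Nat.succ_mul]
    omega

theorem runs_forLoop (hx : x < d)
    (hP : ∀ i s s', P i s → (∀ y, d + 2 < y → s'.reg y = s.reg y) → s'.out = s.out → P i s')
    (hbody : ∀ i < m, ∀ s : State, (∀ y < d, y ≠ x → s.reg y = r y) → s.reg x = i → P i s →
      Runs inp body s T fun s' => (∀ y ≤ d + 2, s'.reg y = s.reg y) ∧ P (i + 1) s')
    (hr : ∀ y < d, s.reg y = r y) (hm : s.reg d = m) (h0 : P 0 s) :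
    Runs inp (forLoop x d body) s (m * (T + 3) + 7)
      fun s' => (∀ y < d, s'.reg y = r y) ∧ P m s' := by
  -- Four steps of preparation, the rounds with the final failing test, and two steps restoring x.
  have key : Runs inp (forLoop x d body) s (1 + (1 + (1 + (1 + (m * (T + 3) + 1 + (1 + 1))))))
      fun s' => (∀ y < d, s'.reg y = r y) ∧ P m s' := by
    unfold forLoop
    refine Runs.seq (Runs.const (Q := fun s' => s' = _) rfl) ?_
    rintro _ rfl
    refine Runs.seq (Runs.add (Q := fun s' => s' = _) rfl) ?_
    rintro _ rfl
    refine Runs.seq (Runs.const (Q := fun s' => s' = _) rfl) ?_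
    rintro _ rfl
    refine Runs.seq (Runs.const (Q := fun s' => s' = _) rfl) ?_
    rintro _ rfl
    refine Runs.seq (runs_while hx hP hbody m 0 (by omega) _ ?_ ?_ ?_ ?_ ?_ ?_) ?_
    · intro y hy hyx
      simp only [State.reg_setReg]
      rw [if_neg hyx, if_neg (by omega), if_neg (by omega), if_neg (by omega), hr y hy]
    · rw [State.reg_setReg, if_pos rfl]
    · simp only [State.reg_setReg]
      rw [if_neg (by omega), if_neg (by omega), if_neg (by omega), if_neg (by omega), hm]
    · simp only [State.reg_setReg]
      rw [if_neg (by omega), if_pos trivial]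
    · simp only [State.reg_setReg]
      rw [if_neg (by omega), if_neg (by omega), if_pos trivial, if_neg (by omega), if_pos trivial,
        hr x hx, Nat.add_zero]
    · refine hP 0 s _ h0 (fun y hy => ?_) rfl
      simp only [State.reg_setReg]
      rw [if_neg (by omega), if_neg (by omega), if_neg (by omega), if_neg (by omega)]
    · rintro s' ⟨h1, h2, h3⟩
      refine Runs.seq (Runs.const (Q := fun s' => s' = _) rfl) ?_
      rintro _ rfl
      refine Runs.add ⟨fun y hy => ?_, ?_⟩
      · simp only [State.reg_setReg]
        by_cases h4 : y = x
        · rw [if_pos h4, if_neg (by omega), if_pos trivial, h2, h4, Nat.add_zero]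
        · rw [if_neg h4, if_neg (by omega), h1 y hy h4]
      · refine hP m s' _ h3 (fun y hy => ?_) rfl
        simp only [State.reg_setReg]
        rw [if_neg (by omega), if_neg (by omega)]
  exact key.mono (by omega) fun _ h => h

end Runs

/-! ### Arithmetic expressions with bounded sums -/

/-- Arithmetic expressions: `sum x a b` is the sum of the values of `b` where the variable `x` ranges
over the numbers less than `a`. -/
inductive Expr
  | var (x : ℕ)
  | const (c : ℕ)
  | add (a b : Expr)
  | sub (a b : Expr)
  | mul (a b : Expr)
  | input (a : Expr)
  | sum (x : ℕ) (a b : Expr)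

namespace Expr

/-- The value of an expression. -/
def eval (inp : List ℕ) : Expr → (ℕ → ℕ) → ℕ
  | var x, env => env x
  | const c, _ => c
  | add a b, env => a.eval inp env + b.eval inp env
  | sub a b, env => a.eval inp env - b.eval inp env
  | mul a b, env => a.eval inp env * b.eval inp env
  | input a, env => inp.getD (a.eval inp env) 0
  | sum x a b, env => ∑ i ∈ Finset.range (a.eval inp env), b.eval inp (Function.update env x i)

/-- The variables of the expression are less than `D`. -/
def Below (D : ℕ) : Expr → Prop
  | var x => x < D
  | const _ => True
  | add a b => a.Below D ∧ b.Below D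
  | sub a b => a.Below D ∧ b.Below D
  | mul a b => a.Below D ∧ b.Below D
  | input a => a.Below D
  | sum x a b => x < D ∧ a.Below D ∧ b.Below D

/-- A program that computes the value of the expression into the register `d`, where the variables
are registers less than `d`. -/
def compile : Expr → ℕ → Program
  | var x, d => .seq (.const d 0) (.add d x d)
  | const c, d => .const d c
  | add a b, d => .seq (a.compile d) (.seq (b.compile (d + 1)) (.add d d (d + 1)))
  | sub a b, d => .seq (a.compile d) (.seq (b.compile (d + 1)) (.sub d d (d + 1)))
  | mul a b, d => .seq (.seq (a.compile (d + 1)) <| .seq (.const (d + 4) 0) <|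
      .seq (forLoop d (d + 1) (.seq (b.compile (d + 5)) (.add (d + 4) (d + 4) (d + 5)))) <|
      .seq (.const (d + 1) 0) (.add (d + 1) (d + 4) (d + 1))) <|
      .seq (.const d 0) (.add d (d + 1) d)
  | input a, d => .seq (a.compile d) (.input d d)
  | sum x a b, d => .seq (a.compile d) <| .seq (.const (d + 3) 0) <|
      .seq (forLoop x d (.seq (b.compile (d + 4)) (.add (d + 3) (d + 3) (d + 4)))) <|
      .seq (.const d 0) (.add d (d + 3) d)

/-- The program of the expression `e` is correct and runs within `T` steps. -/
def Correct (inp : List ℕ) (D : ℕ) (e : Expr) (env : ℕ → ℕ) (T : ℕ) : Prop :=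
  ∀ d, D ≤ d → ∀ s : State, (∀ y < D, s.reg y = env y) →
    Runs inp (e.compile d) s T fun s' =>
      (∀ y < d, s'.reg y = s.reg y) ∧ s'.reg d = e.eval inp env ∧ s'.out = s.out

variable {inp : List ℕ} {D : ℕ} {env : ℕ → ℕ} {a b : Expr} {Ta Tb : ℕ}

theorem correct_var {x : ℕ} (hx : x < D) : Correct inp D (var x) env 2 := by
  intro d hd s hs
  refine Runs.seq (T := 1) (T' := 1) (Runs.const (Q := fun s' => s' = _) rfl) ?_
  rintro _ rfl
  refine Runs.add ⟨fun y hy => ?_, ?_, rfl⟩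
  · simp only [State.reg_setReg]
    rw [if_neg (by omega), if_neg (by omega)]
  · simp only [State.reg_setReg]
    rw [if_pos trivial, if_neg (by omega), if_pos trivial, hs x hx]
    rfl

theorem correct_const (c : ℕ) : Correct inp D (const c) env 1 := by
  intro d hd s hs
  refine Runs.const ⟨fun y hy => ?_, ?_, rfl⟩
  · rw [State.reg_setReg, if_neg (by omega)]
  · rw [State.reg_setReg, if_pos rfl]
    rfl

/-- The second operand is compiled from register d + 1 on, so the first result survives in d. -/
theorem Correct.pair (ha : Correct inp D a env Ta) (hb : Correct inp D b env Tb) {d : ℕ}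
    (hd : D ≤ d) {s : State} (hs : ∀ y < D, s.reg y = env y) {p : Program} {Q : State → Prop}
    (hp : ∀ s' : State, (∀ y < d, s'.reg y = s.reg y) → s'.reg d = a.eval inp env →
      s'.reg (d + 1) = b.eval inp env → s'.out = s.out → Runs inp p s' 1 Q) :
    Runs inp (.seq (a.compile d) (.seq (b.compile (d + 1)) p)) s (Ta + (Tb + 1)) Q := by
  refine (ha d hd s hs).seq fun s1 hs1 => ?_
  obtain ⟨h1, h2, h3⟩ := hs1
  refine (hb (d + 1) (by omega) s1 fun y hy => ?_).seq fun s2 hs2 => ?_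
  · rw [h1 y (by omega), hs y hy]
  · obtain ⟨h4, h5, h6⟩ := hs2
    refine hp s2 (fun y hy => ?_) ?_ h5 (h6.trans h3)
    · rw [h4 y (by omega), h1 y hy]
    · rw [h4 d (by omega), h2]

theorem Correct.add (ha : Correct inp D a env Ta) (hb : Correct inp D b env Tb) :
    Correct inp D (a.add b) env (Ta + (Tb + 1)) := by
  intro d hd s hs
  refine ha.pair hb hd hs fun s' h1 h2 h3 h4 => Runs.add ⟨fun y hy => ?_, ?_, h4⟩
  · rw [State.reg_setReg, if_neg (by omega), h1 y hy]
  · rw [State.reg_setReg, if_pos rfl, h2, h3]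
    rfl

theorem Correct.sub (ha : Correct inp D a env Ta) (hb : Correct inp D b env Tb) :
    Correct inp D (a.sub b) env (Ta + (Tb + 1)) := by
  intro d hd s hs
  refine ha.pair hb hd hs fun s' h1 h2 h3 h4 => Runs.sub ⟨fun y hy => ?_, ?_, h4⟩
  · rw [State.reg_setReg, if_neg (by omega), h1 y hy]
  · rw [State.reg_setReg, if_pos rfl, h2, h3]
    rfl

theorem Correct.input (ha : Correct inp D a env Ta) : Correct inp D a.input env (Ta + 1) := by
  intro d hd s hs
  refine (ha d hd s hs).seq fun s1 hs1 => ?_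
  obtain ⟨h1, h2, h3⟩ := hs1
  refine Runs.input ⟨fun y hy => ?_, ?_, h3⟩
  · rw [State.reg_setReg, if_neg (by omega), h1 y hy]
  · rw [State.reg_setReg, if_pos rfl, h2]
    rfl

/-- The loop that adds up the values of `b`. -/
theorem runs_sumLoop {x d m : ℕ} {envs : ℕ → ℕ → ℕ} (hx : x < d) (hd : D ≤ d) {s : State}
    (hm : s.reg d = m) (hs : ∀ i, ∀ y < D, y ≠ x → s.reg y = envs i y)
    (hx' : x < D → ∀ i, envs i x = i) (hb : ∀ i < m, Correct inp D b (envs i) Tb) :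
    Runs inp (.seq (.const (d + 3) 0) <|
      .seq (forLoop x d (.seq (b.compile (d + 4)) (.add (d + 3) (d + 3) (d + 4)))) <|
      .seq (.const d 0) (.add d (d + 3) d)) s
      (1 + ((m * (Tb + 4) + 7) + (1 + 1))) fun s' => (∀ y < d, s'.reg y = s.reg y) ∧
        s'.reg d = ∑ i ∈ Finset.range m, b.eval inp (envs i) ∧ s'.out = s.out := by
  refine Runs.seq (Runs.const (Q := fun s' => s' = _) rfl) ?_
  rintro _ rfl
  refine Runs.seq (runs_forLoop (T := Tb + 1) (r := s.reg)
    (P := fun j s' => s'.reg (d + 3) = ∑ i ∈ Finset.range j, b.eval inp (envs i) ∧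
      s'.out = s.out) hx ?_ ?_ ?_ ?_ ?_) ?_
  · rintro i s1 s2 ⟨h1, h2⟩ h3 h4
    exact ⟨by rw [h3 _ (by omega), h1], by rw [h4, h2]⟩
  · rintro i hi s1 h1 h2 ⟨h3, h4⟩
    refine (hb i hi (d + 4) (by omega) s1 fun y hy => ?_).seq ?_
    · by_cases hyx : y = x
      · subst hyx
        rw [h2, hx' hy]
      · rw [h1 y (by omega) hyx, hs i y hy hyx]
    · rintro s2 ⟨h5, h6, h7⟩
      refine Runs.add ⟨fun y hy => ?_, ?_, ?_⟩
      · rw [State.reg_setReg, if_neg (by omega), h5 y (by omega)]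
      · rw [State.reg_setReg, if_pos rfl, h5 _ (by omega), h3, h6, Finset.sum_range_succ]
      · rw [State.out_setReg, h7, h4]
  · intro y hy
    rw [State.reg_setReg, if_neg (by omega)]
  · rw [State.reg_setReg, if_neg (by omega), hm]
  · exact ⟨by rw [State.reg_setReg, if_pos rfl, Finset.sum_range_zero], rfl⟩
  · rintro s1 ⟨h1, h2, h3⟩
    refine Runs.seq (Runs.const (Q := fun s' => s' = _) rfl) ?_
    rintro _ rfl
    refine Runs.add ⟨fun y hy => ?_, ?_, h3⟩
    · simp only [State.reg_setReg]
      rw [if_neg (by omega), if_neg (by omega), h1 y hy]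
    · simp only [State.reg_setReg]
      rw [if_pos trivial, if_neg (by omega), if_pos trivial, h2, Nat.add_zero]

theorem Correct.sum {x : ℕ} (hx : x < D) (ha : Correct inp D a env Ta)
    (hb : ∀ i < a.eval inp env, Correct inp D b (Function.update env x i) Tb) :
    Correct inp D (sum x a b) env
      (Ta + (1 + ((a.eval inp env * (Tb + 4) + 7) + (1 + 1)))) := by
  intro d hd s hs
  refine (ha d hd s hs).seq ?_
  rintro s1 ⟨h1, h2, h3⟩
  refine (runs_sumLoop (envs := fun i => Function.update env x i) (by omega) hd h2 ?_ ?_ hb).mono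
    le_rfl ?_
  · intro i y hy hyx
    rw [Function.update_of_ne hyx, h1 y (by omega), hs y hy]
  · intro _ i
    rw [Function.update_self]
  · rintro s2 ⟨h4, h5, h6⟩
    exact ⟨fun y hy => by rw [h4 y hy, h1 y hy], h5, by rw [h6, h3]⟩

/-- The machine cannot multiply, so the product is a sum of equal terms. The loop counter is the
register d, which is not a variable of b, hence the environment is the same in each round. -/
theorem Correct.mul (ha : Correct inp D a env Ta) (hb : Correct inp D b env Tb) :
    Correct inp D (a.mul b) env
      (Ta + (1 + ((a.eval inp env * (Tb + 4) + 7) + (1 + 1))) + 2) := by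
  intro d hd s hs
  have key : Runs inp _ s _ _ := (ha (d + 1) (by omega) s hs).seq fun s1 hs1 =>
    (runs_sumLoop (x := d) (envs := fun _ => env) (b := b) (Tb := Tb) (by omega) (by omega)
      hs1.2.1 (fun i y hy hyx => by rw [hs1.1 y (by omega), hs y hy]) (fun h => by omega)
      fun _ _ => hb).mono le_rfl (R := fun s' => (∀ y < d, s'.reg y = s.reg y) ∧
        s'.reg (d + 1) = (a.mul b).eval inp env ∧ s'.out = s.out) fun s2 hs2 =>
      ⟨fun y hy => by rw [hs2.1 y (by omega), hs1.1 y (by omega)],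
        by rw [hs2.2.1, Finset.sum_const, Finset.card_range]; rfl, by rw [hs2.2.2, hs1.2.2]⟩
  refine (key.seq (q := .seq (.const d 0) (.add d (d + 1) d)) (T' := 1 + 1) ?_).mono le_rfl
    fun _ h => h
  rintro s1 ⟨h1, h2, h3⟩
  refine Runs.seq (Runs.const (Q := fun s' => s' = _) rfl) ?_
  rintro _ rfl
  refine Runs.add ⟨fun y hy => ?_, ?_, h3⟩
  · simp only [State.reg_setReg]
    rw [if_neg (by omega), if_neg (by omega), h1 y hy]
  · simp only [State.reg_setReg]
    rw [if_pos trivial, if_neg (by omega), if_pos trivial, h2, Nat.add_zero]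

/-- An expression can be evaluated in polynomial time. -/
theorem exists_polynomial (D : ℕ) (e : Expr) (he : e.Below D) :
    ∃ p : Polynomial ℕ, ∀ (inp : List ℕ) (B : ℕ) (env : ℕ → ℕ), (∀ a ∈ inp, a ≤ B) →
      (∀ y, env y ≤ B) → e.eval inp env ≤ p.eval B ∧ Correct inp D e env (p.eval B) := by
  have weaken {inp D e env T T'} (h : Correct inp D e env T) (hT : T ≤ T') :
      Correct inp D e env T' :=
    fun d hd s hs => (h d hd s hs).mono hT fun _ h => h
  induction e with
  | var x =>
    refine ⟨.X + 2, fun inp B env _ h => ?_⟩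
    simp only [Polynomial.eval_add, Polynomial.eval_X, Polynomial.eval_ofNat]
    exact ⟨(h x).trans (by omega), weaken (correct_var he) (by omega)⟩
  | const c =>
    refine ⟨.C (c + 1), fun inp B env _ h => ?_⟩
    simp only [Polynomial.eval_C]
    exact ⟨Nat.le_succ c, weaken (correct_const c) (by omega)⟩
  | add a b iha ihb =>
    obtain ⟨p, hp⟩ := iha he.1
    obtain ⟨q, hq⟩ := ihb he.2
    refine ⟨p + q + 1, fun inp B env hi h => ?_⟩
    obtain ⟨h1, h2⟩ := hp inp B env hi h
    obtain ⟨h3, h4⟩ := hq inp B env hi h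
    simp only [Polynomial.eval_add, Polynomial.eval_one, eval]
    exact ⟨by omega, weaken (h2.add h4) (by omega)⟩
  | sub a b iha ihb =>
    obtain ⟨p, hp⟩ := iha he.1
    obtain ⟨q, hq⟩ := ihb he.2
    refine ⟨p + q + 1, fun inp B env hi h => ?_⟩
    obtain ⟨h1, h2⟩ := hp inp B env hi h
    obtain ⟨h3, h4⟩ := hq inp B env hi h
    simp only [Polynomial.eval_add, Polynomial.eval_one, eval]
    exact ⟨by omega, weaken (h2.sub h4) (by omega)⟩
  | mul a b iha ihb =>
    obtain ⟨p, hp⟩ := iha he.1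
    obtain ⟨q, hq⟩ := ihb he.2
    refine ⟨p + p * (q + 4) + 12, fun inp B env hi h => ?_⟩
    obtain ⟨h1, h2⟩ := hp inp B env hi h
    obtain ⟨h3, h4⟩ := hq inp B env hi h
    simp only [Polynomial.eval_add, Polynomial.eval_mul, Polynomial.eval_ofNat, eval]
    have h5 := Nat.mul_le_mul h1 h3
    have h6 := Nat.mul_le_mul_right (q.eval B + 4) h1
    refine ⟨?_, weaken (h2.mul h4) (by omega)⟩
    rw [Nat.mul_add]
    omega
  | input a iha =>
    obtain ⟨p, hp⟩ := iha he
    refine ⟨p + .X + 1, fun inp B env hi h => ?_⟩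
    obtain ⟨h1, h2⟩ := hp inp B env hi h
    simp only [Polynomial.eval_add, Polynomial.eval_one, Polynomial.eval_X, eval]
    refine ⟨?_, weaken h2.input (by omega)⟩
    rw [List.getD_eq_getElem?_getD]
    rcases h3 : inp[a.eval inp env]? with _ | v
    · simp
    · have := hi v (List.mem_of_getElem? h3)
      simp only [Option.getD_some]
      omega
  | sum x a b iha ihb =>
    obtain ⟨p, hp⟩ := iha he.2.1
    obtain ⟨q, hq⟩ := ihb he.2.2
    -- The bound variable takes values up to p(B), so the body runs in an environment bounded by B +
    -- p(B); this is the reason for the composition.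
    refine ⟨p + p * (q.comp (.X + p) + 4) + 12, fun inp B env hi h => ?_⟩
    obtain ⟨h1, h2⟩ := hp inp B env hi h
    have h3 (i) (hi' : i < a.eval inp env) := hq inp (B + p.eval B) (Function.update env x i)
      (fun a ha => (hi a ha).trans (by omega)) fun y => by
        rw [Function.update_apply]
        split_ifs
        · omega
        · exact (h y).trans (by omega)
    simp only [Polynomial.eval_add, Polynomial.eval_mul, Polynomial.eval_ofNat, eval,
      Polynomial.eval_comp, Polynomial.eval_X]
    have h6 := Nat.mul_le_mul_right (q.eval (B + p.eval B) + 4) h1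
    refine ⟨?_, weaken (Correct.sum he.1 h2 fun i hi' => (h3 i hi').2) (by omega)⟩
    have h7 := Finset.sum_le_card_nsmul (Finset.range (a.eval inp env))
      (fun i => b.eval inp (Function.update env x i)) (q.eval (B + p.eval B))
      fun i hi' => (h3 i (Finset.mem_range.1 hi')).1
    rw [Finset.card_range, smul_eq_mul] at h7
    have h8 := Nat.mul_add (a.eval inp env) (q.eval (B + p.eval B)) 4
    omega

end Expr

/-! ### Programs that write values of expressions in nested loops -/

/-- Statements: write the value of an expression, composition, and loops `loop x a p` where the
variable `x` ranges over the numbers less than `a`. -/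
inductive Stmt
  | write (a : Expr)
  | seq (p q : Stmt)
  | loop (x : ℕ) (a : Expr) (p : Stmt)

namespace Stmt

/-- The output written by a statement. -/
def output (inp : List ℕ) : Stmt → (ℕ → ℕ) → List ℕ
  | write a, env => [a.eval inp env]
  | seq p q, env => p.output inp env ++ q.output inp env
  | loop x a p, env => (List.range (a.eval inp env)).flatMap fun i =>
      p.output inp (Function.update env x i)

/-- The variables of the statement are less than `D`. -/
def Below (D : ℕ) : Stmt → Prop
  | write a => a.Below D
  | seq p q => p.Below D ∧ q.Below D
  | loop x a p => x < D ∧ a.Below D ∧ p.Below D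

/-- The program of a statement, which uses registers from `d` on. -/
def compile : Stmt → ℕ → Program
  | write a, d => .seq (a.compile d) (.write d)
  | seq p q, d => .seq (p.compile d) (q.compile d)
  | loop x a p, d => .seq (a.compile d) (forLoop x d (p.compile (d + 3)))

/-- The program of the statement `p` is correct and runs within `T` steps. -/
def Correct (inp : List ℕ) (D : ℕ) (p : Stmt) (env : ℕ → ℕ) (T : ℕ) : Prop :=
  ∀ d, D ≤ d → ∀ s : State, (∀ y < D, s.reg y = env y) →
    Runs inp (p.compile d) s T fun s' =>
      (∀ y < d, s'.reg y = s.reg y) ∧ s'.out = s.out ++ p.output inp env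

variable {inp : List ℕ} {D : ℕ} {env : ℕ → ℕ} {a : Expr} {p q : Stmt} {Ta Tp Tq : ℕ}

theorem correct_write (ha : a.Correct inp D env Ta) : Correct inp D (write a) env (Ta + 1) := by
  intro d hd s hs
  refine (ha d hd s hs).seq ?_
  rintro s1 ⟨h1, h2, h3⟩
  refine Runs.write ⟨h1, ?_⟩
  simp only [h2, h3, output]

theorem Correct.seq (hp : p.Correct inp D env Tp) (hq : q.Correct inp D env Tq) :
    Correct inp D (p.seq q) env (Tp + Tq) := by
  intro d hd s hs
  refine (hp d hd s hs).seq ?_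
  rintro s1 ⟨h1, h2⟩
  refine (hq d hd s1 fun y hy => by rw [h1 y (by omega), hs y hy]).mono le_rfl ?_
  rintro s2 ⟨h3, h4⟩
  refine ⟨fun y hy => by rw [h3 y hy, h1 y hy], ?_⟩
  rw [h4, h2, List.append_assoc]
  rfl

theorem Correct.loop {x : ℕ} (hx : x < D) (ha : a.Correct inp D env Ta)
    (hp : ∀ i < a.eval inp env, p.Correct inp D (Function.update env x i) Tp) :
    Correct inp D (loop x a p) env (Ta + (a.eval inp env * (Tp + 3) + 7)) := by
  intro d hd s hs
  refine (ha d hd s hs).seq ?_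
  rintro s1 ⟨h1, h2, h3⟩
  refine (runs_forLoop (T := Tp) (r := s.reg) (P := fun j s' => s'.out = s.out ++
    (List.range j).flatMap fun i => p.output inp (Function.update env x i)) (by omega)
    ?_ ?_ h1 h2 ?_).mono le_rfl fun _ h => h
  · intro i s1 s2 h4 _ h5
    rw [h5, h4]
  · intro i hi s2 h4 h5 h6
    refine (hp i hi (d + 3) (by omega) s2 fun y hy => ?_).mono le_rfl ?_
    · rw [Function.update_apply]
      split_ifs with hyx
      · rw [hyx, h5]
      · rw [h4 y (by omega) hyx, hs y hy]
    · rintro s3 ⟨h7, h8⟩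
      refine ⟨fun y hy => h7 y (by omega), ?_⟩
      rw [h8, h6, List.range_succ, List.flatMap_append, List.append_assoc, List.flatMap_singleton]
  · simpa using h3

/-- A statement can be executed in polynomial time. -/
theorem exists_polynomial (D : ℕ) (p : Stmt) (hD : p.Below D) :
    ∃ P : Polynomial ℕ, ∀ (inp : List ℕ) (B : ℕ) (env : ℕ → ℕ), (∀ a ∈ inp, a ≤ B) →
      (∀ y, env y ≤ B) → Correct inp D p env (P.eval B) := by
  have weaken {inp D p env T T'} (h : Correct inp D p env T) (hT : T ≤ T') :
      Correct inp D p env T' :=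
    fun d hd s hs => (h d hd s hs).mono hT fun _ h => h
  induction p with
  | write a =>
    obtain ⟨P, hP⟩ := a.exists_polynomial D hD
    refine ⟨P + 1, fun inp B env hi h => ?_⟩
    rw [Polynomial.eval_add, Polynomial.eval_one]
    exact correct_write (hP inp B env hi h).2
  | seq p q ihp ihq =>
    obtain ⟨P, hP⟩ := ihp hD.1
    obtain ⟨Q, hQ⟩ := ihq hD.2
    refine ⟨P + Q, fun inp B env hi h => ?_⟩
    rw [Polynomial.eval_add]
    exact (hP inp B env hi h).seq (hQ inp B env hi h)
  | loop x a p ih =>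
    obtain ⟨P, hP⟩ := a.exists_polynomial D hD.2.1
    obtain ⟨Q, hQ⟩ := ih hD.2.2
    refine ⟨P + (P * (Q.comp (.X + P) + 3) + 7), fun inp B env hi h => ?_⟩
    obtain ⟨h1, h2⟩ := hP inp B env hi h
    simp only [Polynomial.eval_add, Polynomial.eval_mul, Polynomial.eval_ofNat,
      Polynomial.eval_comp, Polynomial.eval_X]
    have h3 (i) (hi' : i < a.eval inp env) := hQ inp (B + P.eval B) (Function.update env x i)
      (fun a ha => (hi a ha).trans (by omega)) fun y => by
        rw [Function.update_apply]
        split_ifs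
        · omega
        · exact (h y).trans (by omega)
    have h4 := Nat.mul_le_mul_right (Q.eval (B + P.eval B) + 3) h1
    exact weaken (Correct.loop hD.1 h2 h3) (by omega)

end Stmt

end RAM

/-! ### Positions in the encoded input and the enumeration of the copies. -/

namespace MixedThin

section Bits

theorem bit_of_true {P : Prop} (h : P) : bit P = 1 := if_pos h

theorem bit_of_false {P : Prop} (h : ¬ P) : bit P = 0 := if_neg h

theorem bit_le_one (P : Prop) : bit P ≤ 1 := by
  by_cases h : P
  · rw [bit_of_true h]
  · rw [bit_of_false h]
    exact Nat.zero_le 1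

end Bits

section Lists

theorem length_encodeRel {n m : ℕ} (r : Fin n → Fin m → Prop) :
    (encodeRel r).length = n * m := by
  simp [encodeRel, List.length_flatMap]

theorem getD_flatMap {α : Type*} (l : List α) (f : α → List ℕ) (c : ℕ)
    (hf : ∀ a, (f a).length = c) (i j : ℕ) (hi : i < l.length) (hj : j < c) :
    (l.flatMap f).getD (c * i + j) 0 = (f l[i]).getD j 0 := by
  induction l generalizing i with
  | nil => simp at hi
  | cons a l ih =>
    rw [List.flatMap_cons]
    rcases i with _ | i
    · rw [Nat.mul_zero, Nat.zero_add, List.getD_append _ _ _ _ (by rwa [hf])]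
      rfl
    · rw [List.getD_append_right _ _ _ _ (by rw [hf, Nat.mul_succ]; omega), hf]
      rw [show c * (i + 1) + j - c = c * i + j by rw [Nat.mul_succ]; omega]
      exact ih i (by simpa using hi)

theorem getD_finRange_flatMap {m : ℕ} (f : Fin m → List ℕ) (c : ℕ)
    (hf : ∀ a, (f a).length = c) (i : Fin m) (j : ℕ) (hj : j < c) :
    ((List.finRange m).flatMap f).getD (c * i + j) 0 = (f i).getD j 0 := by
  rw [getD_flatMap _ _ c hf _ _ (by simp) hj]
  simp

theorem getD_encodeRel {n m : ℕ} (r : Fin n → Fin m → Prop) (a : Fin n) (b : Fin m) :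
    (encodeRel r).getD (m * a + b) 0 = bit (r a b) := by
  unfold encodeRel
  rw [getD_finRange_flatMap _ m (by simp) a b b.2]
  simp

theorem flatMap_range {α : Type*} {m : ℕ} {f : Fin m → List α} {g : ℕ → List α}
    (h : ∀ q : Fin m, g q = f q) : (List.range m).flatMap g = (List.finRange m).flatMap f := by
  rw [← List.map_coe_finRange_eq_range (n := m), List.flatMap_map]
  congr 1
  funext q
  exact h q

/-- `finProdFinEquiv` enumerates pairs row by row, so two nested loops over copies and vertices
visit the elements of the poset in the order of the encoding. -/
theorem finRange_mul (m n : ℕ) :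
    List.finRange (m * n) =
      (List.finRange m).flatMap fun q => (List.finRange n).map fun v => finProdFinEquiv (q, v) := by
  apply List.map_injective_iff.2 Fin.val_injective
  have key : List.range (m * n) =
      (List.range m).flatMap fun q => (List.range n).map fun v => v + n * q := by
    induction m with
    | zero => simp
    | succ m ih =>
      rw [Nat.succ_mul, List.range_add, ih, List.range_succ, List.flatMap_append,
        List.flatMap_singleton]
      congr 2
      funext v
      ring
  rw [List.map_coe_finRange_eq_range, key, List.map_flatMap]
  refine flatMap_range fun q => ?_
  rw [← List.map_coe_finRange_eq_range (n := n), List.map_map, List.map_map]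
  rfl

theorem flatMap_range_mul {α : Type*} {m n : ℕ} {f : Fin (m * n) → List α}
    {g : ℕ → ℕ → List α} (h : ∀ (q : Fin m) (v : Fin n), g q v = f (finProdFinEquiv (q, v))) :
    (List.range m).flatMap (fun q => (List.range n).flatMap fun v => g q v) =
      (List.finRange (m * n)).flatMap f := by
  rw [finRange_mul, List.flatMap_assoc]
  refine flatMap_range fun q => ?_
  rw [List.flatMap_map]
  exact flatMap_range fun v => h q v

end Lists

section Input

variable {n k : ℕ} (G : SimpleGraph (Fin n)) (part : Fin n → Fin k)
  (le : Fin k → Fin k → Fin n → Fin n → Prop)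

theorem length_encodeInput :
    (encodeInput G part le).length = 2 + n * n + n + k * (k * (n * n)) := by
  simp [encodeInput, length_encodeRel, List.length_flatMap]
  ring

theorem getD_encodeInput_zero : (encodeInput G part le).getD 0 0 = n := by
  simp [encodeInput]

theorem getD_encodeInput_one : (encodeInput G part le).getD 1 0 = k := by
  simp [encodeInput]

theorem getD_encodeInput_adj (u v : Fin n) :
    (encodeInput G part le).getD (2 + (n * u + v)) 0 = bit (G.Adj u v) := by
  have h : n * (u : ℕ) + v < n * n := by
    have := Nat.mul_le_mul_left n (Nat.succ_le_of_lt u.2)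
    rw [Nat.mul_succ] at this
    omega
  unfold encodeInput
  rw [List.append_assoc, List.append_assoc,
    List.getD_append_right _ _ _ _ (by simp), List.getD_append _ _ _ _ (by
      rw [length_encodeRel]; simpa using h)]
  simpa using getD_encodeRel G.Adj u v

theorem getD_encodeInput_part (u : Fin n) :
    (encodeInput G part le).getD (2 + n * n + u) 0 = part u := by
  unfold encodeInput
  have hlen : ([n, k] ++ encodeRel G.Adj).length = 2 + n * n := by
    simp [length_encodeRel]
    ring
  rw [List.append_assoc, List.getD_append_right _ _ _ _ (by omega), hlen, Nat.add_sub_cancel_left,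
    List.getD_append _ _ _ _ (by simp)]
  simp

/-- Truncated subtraction expresses the minimum as a - (a - b) and the maximum as a + (b - a). The
matrix for this pair of parts is preceded by k · min + max blocks of length n². -/
theorem getD_encodeInput_ord (u v : Fin n) :
    (encodeInput G part le).getD (2 + n * n + n + (n * (n * (k * (part u - (part u - part v)) +
      (part u + (part v - part u))) + u) + v)) 0 = bit (ord part le u v) := by
  have h : n * (u : ℕ) + v < n * n := by
    have := Nat.mul_le_mul_left n (Nat.succ_le_of_lt u.2)
    rw [Nat.mul_succ] at this
    omega
  have hmin : (part u : ℕ) - (part u - part v) = (min (part u) (part v) : Fin k) := by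
    rw [Fin.coe_min]
    omega
  have hmax : (part u : ℕ) + (part v - part u) = (max (part u) (part v) : Fin k) := by
    rw [Fin.coe_max]
    omega
  rw [hmin, hmax]
  have h2 : n * n * ((max (part u) (part v) : Fin k) : ℕ) + (n * u + v) < k * (n * n) := by
    have := Nat.mul_le_mul_left (n * n) (Nat.succ_le_of_lt (max (part u) (part v)).2)
    rw [Nat.mul_succ, Nat.mul_comm _ k] at this
    omega
  unfold encodeInput
  have hlen : ([n, k] ++ encodeRel G.Adj ++ (List.finRange n).map (fun v => (part v : ℕ))).length =
      2 + n * n + n := by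
    simp [length_encodeRel]
    ring
  rw [List.getD_append_right _ _ _ _ (by rw [hlen]; omega), hlen, Nat.add_sub_cancel_left]
  rw [show n * (n * (k * ((min (part u) (part v) : Fin k) : ℕ) +
      ((max (part u) (part v) : Fin k) : ℕ)) + u) + v =
    k * (n * n) * ((min (part u) (part v) : Fin k) : ℕ) +
      (n * n * ((max (part u) (part v) : Fin k) : ℕ) + (n * u + v)) by ring]
  rw [getD_finRange_flatMap _ (k * (n * n)) (by simp [List.length_flatMap, length_encodeRel]) _ _ h2,
    getD_finRange_flatMap _ (n * n) (by simp [length_encodeRel]) _ _ h, getD_encodeRel]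
  congr 1
  refine propext ⟨fun h => h.2.2.2, fun h => ⟨min_le_max, ?_, ?_, h⟩⟩
  · rcases min_cases (part u) (part v) with h | h
    · exact Or.inl h.1.symm
    · exact Or.inr (max_eq_left h.2.le).symm
  · rcases min_cases (part u) (part v) with h | h
    · exact Or.inr (max_eq_right h.2).symm
    · exact Or.inl h.1.symm

/-- For n = 0 the input has length 2, while its entry k is arbitrary; for n > 0 the k² order
matrices make the input long enough. -/
theorem le_length_encodeInput (hn : n ≠ 0) :
    ∀ a ∈ encodeInput G part le, a ≤ (encodeInput G part le).length := by
  have hn' : 0 < n := Nat.pos_of_ne_zero hn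
  have h1 : n ≤ n * n := Nat.le_mul_of_pos_left n hn'
  have h2 : k ≤ k * (k * (n * n)) := by
    rcases Nat.eq_zero_or_pos k with rfl | hk
    · simp
    · exact Nat.le_mul_of_pos_right k (by positivity)
  have h3 {m m' : ℕ} (r : Fin m → Fin m' → Prop) : ∀ a ∈ encodeRel r, a ≤ 1 := by
    intro a ha
    simp only [encodeRel, List.mem_flatMap, List.mem_map] at ha
    obtain ⟨_, _, _, _, rfl⟩ := ha
    exact bit_le_one _
  rw [length_encodeInput]
  intro a ha
  simp only [encodeInput, List.mem_append, List.mem_flatMap, List.mem_map, List.mem_cons,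
    List.not_mem_nil, or_false] at ha
  obtain ((((rfl | rfl) | ha) | ⟨v, _, rfl⟩) | ⟨_, _, _, _, ha⟩) := ha
  · omega
  · omega
  · have := h3 _ _ ha
    omega
  · omega
  · have := h3 _ _ ha
    omega

end Input

end MixedThin

/-! ### The marked poset as arithmetic expressions. -/

namespace RAM.Expr

/-- The number of vertices. -/
def order : Expr := .input (.const 0)

/-- The number of parts. -/
def parts : Expr := .input (.const 1)

/-- Negation of a truth value. -/
def not (a : Expr) : Expr := .sub (.const 1) a

/-- Disjunction of truth values. -/
def or (a b : Expr) : Expr := not (.mul (not a) (not b))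

/-- Equality. -/
def eq (a b : Expr) : Expr := .sub (.const 1) (.add (.sub a b) (.sub b a))

/-- Comparison. -/
def le (a b : Expr) : Expr := .sub (.const 1) (.sub a b)

/-- Existence of a vertex `x`. -/
def exists_ (x : ℕ) (a : Expr) : Expr := not (not (.sum x order a))

/-- Adjacency of two vertices. -/
def adj (a b : Expr) : Expr := .input (.add (.const 2) (.add (.mul order a) b))

/-- The part of a vertex. -/
def part (a : Expr) : Expr := .input (.add (.add (.const 2) (.mul order order)) a)

/-- The order of two vertices. -/
def ord (a b : Expr) : Expr :=
  .input (.add (.add (.add (.const 2) (.mul order order)) order)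
    (.add (.mul order (.add (.mul order (.add
      (.mul parts (.sub (part a) (.sub (part a) (part b))))
      (.add (part a) (.sub (part b) (part a))))) a)) b))

/-- The strict order of two vertices. -/
def lt (a b : Expr) : Expr := .mul (ord a b) (not (eq a b))

/-- The edges between two parts violate the conditions for two vertices from the first part. -/
def violation (i j : Expr) : Expr :=
  exists_ 10 <| exists_ 11 <| exists_ 12 <|
    .mul (.mul (eq (part (.var 10)) i) (.mul (eq (part (.var 11)) i) (eq (part (.var 12)) j))) <|
    or (.mul (.mul (lt (.var 10) (.var 11)) (lt (.var 11) (.var 12)))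
        (.mul (adj (.var 10) (.var 12)) (not (adj (.var 11) (.var 12)))))
      (.mul (.mul (lt (.var 12) (.var 10)) (lt (.var 10) (.var 11)))
        (.mul (adj (.var 11) (.var 12)) (not (adj (.var 10) (.var 12)))))

/-- The complement is chosen for two parts. -/
def flip (i j : Expr) : Expr := or (violation i j) (violation j i)

/-- Two vertices are separated. -/
def sep (a b : Expr) : Expr :=
  .mul (lt a b) (eq (adj a b) (flip (part a) (part b)))

/-- The order of the copies of two vertices. -/
def copiesLE (q a q' b : Expr) : Expr :=
  or (.mul (or (eq q q') (eq q (.const 0))) (.mul (eq (part a) (part b)) (ord a b)))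
    (.mul (le q (.const 1)) (.mul (eq q' (.add (part a) (.const 2))) (sep a b)))

/-- The number of the first mark that marks the vertices for which the complement is chosen. -/
def flipOffset : Expr := .add (.mul (.const 2) parts) (.const 2)

/-- The marks of the copies of a vertex. -/
def copiesMark (c q a : Expr) : Expr :=
  or (eq (part a) c) (or (eq (.add q parts) c)
    (.mul (le flipOffset c) (flip (part a) (.sub c flipOffset))))

end RAM.Expr

namespace RAM

/-- Write the order of the copies and the marks. -/
def encodeStmt : Stmt :=
  .seq (.write (.mul (.add Expr.parts (.const 2)) Expr.order)) <| .seq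
    (.loop 1 (.add Expr.parts (.const 2)) <| .loop 2 Expr.order <|
      .loop 3 (.add Expr.parts (.const 2)) <| .loop 4 Expr.order <|
        .write (Expr.copiesLE (.var 1) (.var 2) (.var 3) (.var 4)))
    (.loop 5 (.add (.mul (.const 3) Expr.parts) (.const 2)) <|
      .loop 1 (.add Expr.parts (.const 2)) <| .loop 2 Expr.order <|
        .write (Expr.copiesMark (.var 5) (.var 1) (.var 2)))

theorem below_encodeStmt : encodeStmt.Below 20 := by
  simp [encodeStmt, Stmt.Below, Expr.Below, Expr.parts, Expr.order, Expr.copiesLE, Expr.or,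
    Expr.not, Expr.eq, Expr.le, Expr.exists_, Expr.adj, Expr.part, Expr.ord, Expr.lt,
    Expr.violation, Expr.flip, Expr.sep, Expr.flipOffset, Expr.copiesMark]

/-- The program that computes the marked poset. -/
def encodeProgram : Program :=
  .seq (.const 20 0) (.seq (.input 20 20) (.ite 20 (encodeStmt.compile 21) (.write 20)))

end RAM

/-! ### Correctness of the expressions and of the program. -/

namespace MixedThin

open RAM (Expr)

section Bits

variable {inp : List ℕ} {env : ℕ → ℕ} {a b : Expr} {P Q : Prop}

theorem eval_not (ha : a.eval inp env = bit P) : a.not.eval inp env = bit (¬ P) := by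
  simp only [Expr.not, Expr.eval, ha]
  by_cases h : P <;> simp [bit, h]

/-- The second factor needs to be a truth value only if the first holds, so the first can guard the
meaning of the second. -/
theorem eval_mul (ha : a.eval inp env = bit P) (hb : P → b.eval inp env = bit Q) :
    (a.mul b).eval inp env = bit (P ∧ Q) := by
  simp only [Expr.eval, ha]
  by_cases h : P
  · rw [hb h, bit_of_true h, one_mul, and_iff_right h]
  · rw [bit_of_false h, zero_mul, bit_of_false fun h' => h h'.1]

theorem eval_or (ha : a.eval inp env = bit P) (hb : b.eval inp env = bit Q) :
    (a.or b).eval inp env = bit (P ∨ Q) := by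
  have h := eval_not (eval_mul (eval_not ha) fun _ => eval_not hb)
  rwa [not_and_or, not_not, not_not] at h

theorem eval_eq {x y : ℕ} (ha : a.eval inp env = x) (hb : b.eval inp env = y) :
    (a.eq b).eval inp env = bit (x = y) := by
  simp only [Expr.eq, Expr.eval, ha, hb]
  by_cases h : x = y
  · simp [bit, h]
  · rw [bit_of_false h]
    omega

theorem eval_le {x y : ℕ} (ha : a.eval inp env = x) (hb : b.eval inp env = y) :
    (a.le b).eval inp env = bit (x ≤ y) := by
  simp only [Expr.le, Expr.eval, ha, hb]
  by_cases h : x ≤ y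
  · rw [bit_of_true h]
    omega
  · rw [bit_of_false h]
    omega

theorem eval_iff (ha : a.eval inp env = bit P) (hb : b.eval inp env = bit Q) :
    (a.eq b).eval inp env = bit (P ↔ Q) := by
  rw [eval_eq ha hb]
  congr 1
  by_cases hP : P <;> by_cases hQ : Q <;> simp [bit, hP, hQ]

end Bits

section Program

variable {n k : ℕ} (G : SimpleGraph (Fin n)) (part : Fin n → Fin k)
  (le : Fin k → Fin k → Fin n → Fin n → Prop) {env : ℕ → ℕ} {a b i j c q q' : Expr}
  {u v : Fin n} {i₀ j₀ : Fin k}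

theorem eval_order : Expr.order.eval (encodeInput G part le) env = n :=
  getD_encodeInput_zero G part le

theorem eval_parts : Expr.parts.eval (encodeInput G part le) env = k :=
  getD_encodeInput_one G part le

/-- The sum counts the witnesses; the double negation cuts it down to 0 or 1. -/
theorem eval_exists {x : ℕ} {P : Fin n → Prop}
    (ha : ∀ u : Fin n, a.eval (encodeInput G part le) (Function.update env x u) = bit (P u)) :
    (Expr.exists_ x a).eval (encodeInput G part le) env = bit (∃ u, P u) := by
  simp only [Expr.exists_, Expr.not, Expr.eval, eval_order, Finset.sum_range, ha]
  by_cases h : ∃ u, P u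
  · rw [bit_of_true h]
    obtain ⟨u, hu⟩ := h
    have := Finset.single_le_sum (f := fun u => bit (P u)) (fun _ _ => Nat.zero_le _)
      (Finset.mem_univ u)
    simp only [bit_of_true hu] at this
    omega
  · rw [bit_of_false h, Finset.sum_eq_zero fun u _ => bit_of_false fun hu => h ⟨u, hu⟩]
    rfl

theorem eval_adj (ha : a.eval (encodeInput G part le) env = u)
    (hb : b.eval (encodeInput G part le) env = v) :
    (Expr.adj a b).eval (encodeInput G part le) env = bit (G.Adj u v) := by
  simp only [Expr.adj, Expr.eval, eval_order, ha, hb]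
  exact getD_encodeInput_adj G part le u v

theorem eval_part (ha : a.eval (encodeInput G part le) env = u) :
    (Expr.part a).eval (encodeInput G part le) env = part u := by
  simp only [Expr.part, Expr.eval, eval_order, ha]
  exact getD_encodeInput_part G part le u

theorem eval_ord (ha : a.eval (encodeInput G part le) env = u)
    (hb : b.eval (encodeInput G part le) env = v) :
    (Expr.ord a b).eval (encodeInput G part le) env = bit (ord part le u v) := by
  simp only [Expr.ord, Expr.eval, eval_order, eval_parts, eval_part G part le ha,
    eval_part G part le hb, ha, hb]
  exact getD_encodeInput_ord G part le u v

theorem eval_lt (ha : a.eval (encodeInput G part le) env = u)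
    (hb : b.eval (encodeInput G part le) env = v) :
    (Expr.lt a b).eval (encodeInput G part le) env = bit (ord part le u v ∧ u ≠ v) := by
  refine (eval_mul (eval_ord G part le ha hb) fun _ => eval_not (eval_eq ha hb)).trans ?_
  rw [← Fin.ext_iff]

theorem not_isConvex_iff :
    ¬ IsConvex part le i₀ j₀ G.Adj ↔ ∃ u v w, (part u = i₀ ∧ part v = i₀ ∧ part w = j₀) ∧
      (((ord part le u v ∧ u ≠ v) ∧ (ord part le v w ∧ v ≠ w)) ∧ (G.Adj u w ∧ ¬ G.Adj v w) ∨
        ((ord part le w u ∧ w ≠ u) ∧ (ord part le u v ∧ u ≠ v)) ∧ (G.Adj v w ∧ ¬ G.Adj u w)) := by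
  unfold IsConvex
  push Not
  refine exists_congr fun u => exists_congr fun v => exists_congr fun w => ?_
  tauto

/-- The three quantifiers rebind the variables 10, 11 and 12, so the expressions for the parts must
keep their values under all changes of these. -/
theorem eval_violation
    (hi : ∀ x y z, i.eval (encodeInput G part le)
      (Function.update (Function.update (Function.update env 10 x) 11 y) 12 z) = i₀)
    (hj : ∀ x y z, j.eval (encodeInput G part le)
      (Function.update (Function.update (Function.update env 10 x) 11 y) 12 z) = j₀) :
    (Expr.violation i j).eval (encodeInput G part le) env =
      bit (¬ IsConvex part le i₀ j₀ G.Adj) := by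
  rw [not_isConvex_iff]
  refine eval_exists G part le fun u => eval_exists G part le fun v =>
    eval_exists G part le fun w => ?_
  generalize henv : Function.update (Function.update (Function.update env 10 (u : ℕ)) 11 (v : ℕ)) 12
    (w : ℕ) = env'
  have hu : (Expr.var 10).eval (encodeInput G part le) env' = u := by simp [← henv, Expr.eval]
  have hv : (Expr.var 11).eval (encodeInput G part le) env' = v := by simp [← henv, Expr.eval]
  have hw : (Expr.var 12).eval (encodeInput G part le) env' = w := by simp [← henv, Expr.eval]
  have hi' : i.eval (encodeInput G part le) env' = i₀ := henv ▸ hi u v w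
  have hj' : j.eval (encodeInput G part le) env' = j₀ := henv ▸ hj u v w
  refine eval_mul ?_ fun _ => ?_
  · simp only [Fin.ext_iff]
    exact eval_mul (eval_eq (eval_part G part le hu) hi') fun _ =>
      eval_mul (eval_eq (eval_part G part le hv) hi') fun _ =>
        eval_eq (eval_part G part le hw) hj'
  · refine eval_or (eval_mul (eval_mul (eval_lt G part le hu hv) fun _ => eval_lt G part le hv hw)
      fun _ => eval_mul (eval_adj G part le hu hw) fun _ => eval_not (eval_adj G part le hv hw))
      (eval_mul (eval_mul (eval_lt G part le hw hu) fun _ => eval_lt G part le hu hv)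
      fun _ => eval_mul (eval_adj G part le hv hw) fun _ => eval_not (eval_adj G part le hu hw))

theorem eval_flip
    (hi : ∀ x y z, i.eval (encodeInput G part le)
      (Function.update (Function.update (Function.update env 10 x) 11 y) 12 z) = i₀)
    (hj : ∀ x y z, j.eval (encodeInput G part le)
      (Function.update (Function.update (Function.update env 10 x) 11 y) 12 z) = j₀) :
    (Expr.flip i j).eval (encodeInput G part le) env = bit (flip G part le i₀ j₀) := by
  unfold flip
  rw [not_and_or]
  exact eval_or (eval_violation G part le hi hj) (eval_violation G part le hj hi)

theorem eval_sep {x y : ℕ} (hx : x < 10) (hy : y < 10) (hu : env x = u) (hv : env y = v) :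
    (Expr.sep (.var x) (.var y)).eval (encodeInput G part le) env =
      bit (Sep G part le u v) := by
  unfold Sep
  rw [← and_assoc]
  have h {x : ℕ} (hx : x < 10) {u : Fin n} (hu : env x = u) (a b c : ℕ) :
      (Expr.part (.var x)).eval (encodeInput G part le)
        (Function.update (Function.update (Function.update env 10 a) 11 b) 12 c) = part u := by
    refine eval_part G part le ?_
    simp only [Expr.eval]
    rw [Function.update_of_ne (by omega), Function.update_of_ne (by omega),
      Function.update_of_ne (by omega), hu]
  exact eval_mul (eval_lt G part le hu hv) fun _ => eval_iff (eval_adj G part le hu hv)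
    (eval_flip G part le (h hx hu) (h hy hv))

theorem eval_copiesLE {q q' : Fin (k + 2)} (h1 : env 1 = q) (h2 : env 2 = u) (h3 : env 3 = q')
    (h4 : env 4 = v) :
    (Expr.copiesLE (.var 1) (.var 2) (.var 3) (.var 4)).eval (encodeInput G part le) env =
      bit (CopiesLE G part le (q, u) (q', v)) := by
  unfold CopiesLE
  simp only [Fin.ext_iff]
  have hpu : (Expr.part (.var 2)).eval (encodeInput G part le) env = part u :=
    eval_part G part le h2
  have hpv : (Expr.part (.var 4)).eval (encodeInput G part le) env = part v :=
    eval_part G part le h4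
  refine eval_or (eval_mul (eval_or (eval_eq h1 h3) (eval_eq h1 rfl)) fun _ =>
    eval_mul (eval_eq hpu hpv) fun _ => eval_ord G part le h2 h4)
    (eval_mul (eval_le h1 rfl) fun _ => eval_mul (eval_eq h3 ?_) fun _ =>
      eval_sep G part le (by omega) (by omega) h2 h4)
  simp only [Expr.eval, hpu]

theorem eval_copiesMark {c : Fin (3 * k + 2)} {q : Fin (k + 2)} (h5 : env 5 = c) (h1 : env 1 = q)
    (h2 : env 2 = u) :
    (Expr.copiesMark (.var 5) (.var 1) (.var 2)).eval (encodeInput G part le) env =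
      bit (copiesMark G part le c (q, u)) := by
  have hpu : (Expr.part (.var 2)).eval (encodeInput G part le) env = part u :=
    eval_part G part le h2
  have hoff (env : ℕ → ℕ) : Expr.flipOffset.eval (encodeInput G part le) env = 2 * k + 2 := by
    simp only [Expr.flipOffset, Expr.eval, eval_parts]
  have hc5 : (Expr.var 5).eval (encodeInput G part le) env = c := h5
  have key : (Expr.mul (Expr.le Expr.flipOffset (.var 5))
      (Expr.flip (Expr.part (.var 2)) (.sub (.var 5) Expr.flipOffset))).eval
        (encodeInput G part le) env = bit (∃ j : Fin k, (j : ℕ) + (2 * k + 2) = c ∧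
          flip G part le (part u) j) := by
    by_cases hc : 2 * k + 2 ≤ (c : ℕ)
    · have hlt : (c : ℕ) - (2 * k + 2) < k := by omega
      refine (eval_mul (eval_le (hoff env) hc5) fun _ => eval_flip G part le (i₀ := part u)
        (j₀ := ⟨c - (2 * k + 2), hlt⟩) ?_ ?_).trans ?_
      · intro x y z
        refine eval_part G part le ?_
        simp [Expr.eval, h2]
      · intro x y z
        simp [Expr.eval, hoff, h5]
      · congr 1
        refine propext ⟨fun h => ⟨_, Nat.sub_add_cancel hc, h.2⟩, fun h => ⟨hc, ?_⟩⟩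
        obtain ⟨j, hj, h⟩ := h
        have : (⟨c - (2 * k + 2), hlt⟩ : Fin k) = j := Fin.ext (by simp only; omega)
        rwa [this]
    -- The guard fails, so the value of the second factor is irrelevant and any proposition can
    -- stand for it.
    · refine (eval_mul (Q := False) (eval_le (hoff env) hc5) fun h => absurd h hc).trans ?_
      congr 1
      refine propext ⟨fun h => h.2.elim, ?_⟩
      rintro ⟨j, hj, -⟩
      omega
  refine eval_or (eval_eq hpu h5) (eval_or (eval_eq ?_ h5) key)
  simp only [Expr.eval, eval_parts, h1]

variable {G part le} in
theorem output_encodeStmt (h : IsWitness G part le) :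
    RAM.encodeStmt.output (encodeInput G part le) (fun _ => 0) =
      encodeMarkedPoset (copiesOrder h finProdFinEquiv.symm)
        (fun c : Fin (3 * k + 2) => {a | copiesMark G part le c (finProdFinEquiv.symm a)}) := by
  unfold RAM.encodeStmt encodeMarkedPoset
  simp only [RAM.Stmt.output, List.append_assoc]
  refine congrArg₂ _ (congrArg (fun x => [x]) ?_) (congrArg₂ _ ?_ ?_)
  · simp only [Expr.eval, eval_parts, eval_order]
  · simp only [encodeRel, Expr.eval, eval_parts, eval_order]
    refine flatMap_range_mul fun q u => ?_
    rw [← List.flatMap_pure_eq_map]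
    refine flatMap_range_mul fun q' v => ?_
    refine congrArg (fun x => [x]) ?_
    refine (eval_copiesLE G part le (q := q) (u := u) (q' := q') (v := v) ?_ ?_ ?_ ?_).trans ?_
    · simp
    · simp
    · simp
    · simp
    · congr 1
      change CopiesLE _ _ _ _ _ = CopiesLE _ _ _ _ _
      simp only [Equiv.symm_apply_apply]
  · simp only [encodeRel, Expr.eval, eval_parts, eval_order]
    refine flatMap_range fun c => ?_
    rw [← List.flatMap_pure_eq_map]
    refine flatMap_range_mul fun q u => ?_
    refine congrArg (fun x => [x]) ?_
    refine (eval_copiesMark G part le (c := c) (q := q) (u := u) ?_ ?_ ?_).trans ?_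
    · simp
    · simp
    · simp
    · simp only [Set.mem_ofPred_eq, Equiv.symm_apply_apply]

end Program

theorem exists_outputsWithin : ∃ p : Polynomial ℕ, ∀ (k n : ℕ) (G : SimpleGraph (Fin n))
    (part : Fin n → Fin k) (le : Fin k → Fin k → Fin n → Fin n → Prop)
    (h : IsWitness G part le), RAM.OutputsWithin RAM.encodeProgram (encodeInput G part le)
      (encodeMarkedPoset (copiesOrder h finProdFinEquiv.symm)
        (fun c : Fin (3 * k + 2) => {a | copiesMark G part le c (finProdFinEquiv.symm a)}))
      (p.eval (encodeInput G part le).length) := by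
  obtain ⟨p, hp⟩ := RAM.encodeStmt.exists_polynomial 20 RAM.below_encodeStmt
  refine ⟨p + 4, fun k n G part le h => ?_⟩
  rw [Polynomial.eval_add, Polynomial.eval_ofNat]
  have key : RAM.Runs (encodeInput G part le) RAM.encodeProgram RAM.State.init
      (1 + (1 + (p.eval (encodeInput G part le).length + 2)))
      fun s => s.out = encodeMarkedPoset (copiesOrder h finProdFinEquiv.symm)
        (fun c : Fin (3 * k + 2) => {a | copiesMark G part le c (finProdFinEquiv.symm a)}) := by
    refine RAM.Runs.seq (RAM.Runs.const (Q := fun s => s = _) rfl) ?_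
    rintro _ rfl
    refine RAM.Runs.seq (RAM.Runs.input (Q := fun s => s = _) rfl) ?_
    rintro _ rfl
    rw [RAM.State.reg_setReg, if_pos rfl, getD_encodeInput_zero]
    set s := (RAM.State.init.setReg 20 0).setReg 20 n with hs
    have hn : s.reg 20 = n := by rw [hs, RAM.State.reg_setReg, if_pos rfl]
    -- For the empty graph the loops over k would not be polynomial in the input length 2; the poset
    -- is then empty and its encoding is the single number 0, which register 20 holds.
    by_cases h0 : n = 0
    · subst h0
      refine ⟨2, _, by omega, .ite_false hn (.write s 20), ?_⟩
      change [] ++ [s.reg 20] = _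
      rw [hn]
      simp [encodeMarkedPoset, encodeRel]
    -- The variables are the registers below 20, still zero here; register 20 holds n, so working
    -- space starts at 21.
    · obtain ⟨t, s', ht, hex, -, hout⟩ := hp (encodeInput G part le) _ (fun _ => 0)
        (le_length_encodeInput G part le h0) (fun _ => Nat.zero_le _) 21 (by omega) s
        (fun y hy => by
          rw [hs, RAM.State.reg_setReg, if_neg (by omega), RAM.State.reg_setReg, if_neg (by omega)]
          rfl)
      refine ⟨t + 1, s', by omega, .ite_true (by rwa [hn]) hex, ?_⟩
      refine hout.trans ?_
      rw [output_encodeStmt h]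
      rfl
  obtain ⟨t, s, ht, hex, hout⟩ := key
  exact ⟨t, s, by omega, hex, hout⟩

end MixedThin

theorem theorem4 :
    ∃ T : ℕ → FOTransduction.Transduction FirstOrder.Language.order FirstOrder.Language.graph,
      (∀ k : ℕ, 1 ≤ k →
        MixedThin.inversionFreeProper.{u} k ⊆
          (T k).image (MixedThin.posetsWidthLE.{u} (5 * k.choose 2 + 5 * k))) ∧
      ∃ (prog : RAM.Program) (p : Polynomial ℕ),
        ∀ (k : ℕ), 1 ≤ k → ∀ (n : ℕ) (G : SimpleGraph (Fin n)) (part : Fin n → Fin k)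
          (le : Fin k → Fin k → Fin n → Fin n → Prop), MixedThin.IsWitness G part le →
          ∃ (N : ℕ) (hN : n ≤ N) (po : PartialOrder (Fin N)) (M : Fin (T k).marks → Set (Fin N)),
            MixedThin.WidthLE po (5 * k.choose 2 + 5 * k) ∧
            (T k).Interprets (MixedThin.posetStructure po) M G.structure (Fin.castLE hN) ∧
            RAM.OutputsWithin prog (MixedThin.encodeInput G part le)
              (MixedThin.encodeMarkedPoset po M)
              (p.eval (MixedThin.encodeInput G part le).length) := by
  refine ⟨MixedThin.transduction, fun k _ => MixedThin.inversionFreeProper_subset k, ?_⟩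
  obtain ⟨p, hp⟩ := MixedThin.exists_outputsWithin
  refine ⟨RAM.encodeProgram, p, fun k _ n G part le h => ?_⟩
  refine ⟨(k + 2) * n, Nat.le_mul_of_pos_left n (by omega),
    MixedThin.copiesOrder h finProdFinEquiv.symm,
    fun c : Fin (3 * k + 2) => {a | MixedThin.copiesMark G part le c (finProdFinEquiv.symm a)},
    MixedThin.widthLE_copiesOrder h _, ?_, hp k n G part le h⟩
  -- `finProdFinEquiv` sends (0, v) to v, so copy 0 is the initial segment of the carrier and the
  -- vertices embed by `Fin.castLE`.
  convert MixedThin.interprets_transduction h finProdFinEquiv.symm using 2 with v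
  refine Fin.ext ?_
  simp [finProdFinEquiv]
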